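/- Let $p,q,r,s\in\mathbb C$ and let $\mathcal A\subset(\mathbb C^4)^*$ be the configuration consisting of the covectors $e^i$ ($1\le i\le 3$) with multiplicity $p$, $e^4$ with multiplicity $q$, $e^i\pm e^j$ ($1\le i<j\le 3$) with multiplicity $r$, and $\tfrac12(e^1\pm e^2\pm e^3\pm e^4)$ (all signs independent) with multiplicity $s$, where $e^1,\dots,e^4$ are the coordinate covectors. Write $c_\alpha$ for the multiplicity of $\alpha$. For a finite configuration $(\mathcal A,c)$ in $V^*$, $\dim_{\mathbb C} V=N$, put $G(u,v)=\sum_{\alpha\in\mathcal A}c_\alpha\alpha(u)\alpha(v)$ and, when $G$ is non-degenerate, define $\beta^\vee\in V$ by $G(\beta^\vee,v)=\beta(v)$ for all $v$. For $\alpha\in\mathcal A$, the $\alpha$-series are the equivalence classes of the covectors of $\mathcal A$ not collinear with $\alpha$ under the relation: $\beta+\gamma\in\mathbb Z\alpha$ or $\beta-\gamma\in\mathbb Z\alpha$. The pair $(\mathcal A,c)$ is a trigonometric $\vee$-system if $\mathcal A$ lies in a lattice spanned by a basis of $V^*$, $G$ is non-degenerate, and $\sum_{\beta\in\Gamma}c_\beta\,\alpha(\beta^\vee)\,\alpha\wedge\beta=0$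 for every $\alpha\in\mathcal A$ and every $\alpha$-series $\Gamma$. (1) Suppose that $4r+s\ne0$, $p=2r+s$, $q=\dfrac{s(s-2r)}{4r+s}$ and $ps\neq0$. Then $(\mathcal A,c)$ is a trigonometric $\vee$-system. Moreover, for $\lambda=6\sqrt3\,(2r+s)(4r+s)^{-1/2}$ (with either choice of the square root) the function $$F(x,y)=\tfrac13y^3+\sum_{\alpha\in\mathcal A}c_\alpha\alpha(x)^2y+\lambda\sum_{\alpha\in\mathcal A}c_\alpha f(\alpha(x)),\qquad x\in\mathbb C^4,\ y=x_5\in\mathbb C,$$ where $f$ is any branch of the multivalued function on $\mathbb C\setminus\pi\mathbb Z$ obtained by analytic continuation of $\tfrac16iz^3+\tfrac14\mathrm{Li}_3(e^{-2iz})$ from the half-plane $\operatorname{Im}z<0$, satisfies the WDVV equations: at every point $(x,y)$ such that all $\alpha(x)$ lie in the domain of the branch, $F$ is holomorphic, the matrix $F_5$ is invertible, and $F_iF_5^{-1}F_j=F_jF_5^{-1}F_i$ for $i,j=1,\dots,4$, where $(F_i)_{kl}=\partial^3F/\partial x_i\partial x_k\partial x_l$ ($k,l=1,\dots,5$). (2)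 In general $(\mathcal A,c)$ is not a restriction of a root system. Precisely: there is a countable set $T\subset\mathbb C$ such that, for all $p,q,r,s$ as in (1) with $r/s\notin T$, the configuration is not a restriction of a root system. Here a configuration in $V^*$ is called a restriction of a root system if there are a finite crystallographic root system $R\subset E^*$ (not necessarily reduced or irreducible, $E$ a finite-dimensional complex space) with a Weyl-group-invariant function $m\colon R\to\mathbb C$, a subset $B=R\cap\langle B\rangle$, and a linear isomorphism $\psi$ of $V$ onto $\{x\in E:\beta(x)=0\ \forall\beta\in B\}$, such that the non-zero covectors $\alpha\circ\psi$, $\alpha\in R^+$, coincide with the covectors of the configuration up to sign, the multiplicities of covectors that coincide up to sign being added and covectors of total multiplicity zero being disregarded. -/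

import Mathlib

open Module Topology

namespace TrigVee

noncomputable section

/-! Trigonometric vee-systems. A configuration is a finite indexed family of covectors `α k`
together with a family of multiplicities `c k`. -/

section VeeSystems

variable {V : Type*} [AddCommGroup V] [Module ℂ V] {κ : Type*} [Fintype κ]

/-- The bilinear form `G(u, v) = ∑ c_α α(u) α(v)`. -/
def form (α : κ → Dual ℂ V) (c : κ → ℂ) : LinearMap.BilinForm ℂ V :=
  ∑ k, c k • (α k).smulRight (α k)

/-- The vector `γ^∨`, determined by `G(γ^∨, v) = γ(v)` for all `v`. -/
def vee [FiniteDimensional ℂ V] (α : κ → Dual ℂ V) (c : κ → ℂ)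
    (h : (form α c).Nondegenerate) (γ : Dual ℂ V) : V :=
  ((form α c).toDual h).symm γ

/-- `α ∧ β = α ⊗ β - β ⊗ α`, as the bilinear form `(a, b) ↦ α(a) β(b) - α(b) β(a)`. -/
def wedge (α β : Dual ℂ V) : LinearMap.BilinForm ℂ V :=
  α.smulRight β - β.smulRight α

/-- The members of the `α i`-series through `α k`: all `α j` such that `α k + α j` or `α k - α j`
is an integer multiple of `α i`. -/
def InSeries (α : κ → Dual ℂ V) (i k j : κ) : Prop :=
  ∃ m : ℤ, α k + α j = m • α i ∨ α k - α j = m • α i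

open Classical in
/-- A trigonometric vee-system: the covectors lie in a lattice of full rank, the form `G` is
non-degenerate, and for every covector `α i` and every `α i`-series (the series being the classes
into which `InSeries` divides the covectors not collinear with `α i`) the sum of
`c_β α(β^∨) α ∧ β` over the series vanishes. -/
def IsTrigVeeSystem [FiniteDimensional ℂ V] (α : κ → Dual ℂ V) (c : κ → ℂ) : Prop :=
  (∃ b : Basis (Fin (finrank ℂ V)) ℂ (Dual ℂ V),
    ∀ k, α k ∈ Submodule.span ℤ (Set.range b)) ∧
  ∃ h : (form α c).Nondegenerate, ∀ i k, (∀ t : ℂ, α k ≠ t • α i) →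
    ∑ j with InSeries α i k j, (c j * α i (vee α c h (α j))) • wedge (α i) (α j) = 0

end VeeSystems

/-! The multivalued function `f(z) = (i/6) z^3 + (1/4) Li_3(e^{-2iz})`. -/

/-- The trilogarithm on the open unit disc. -/
def li3 (w : ℂ) : ℂ := ∑' n : ℕ, w ^ (n + 1) / ((n : ℂ) + 1) ^ 3

/-- `(i/6) z^3 + (1/4) Li_3(e^{-2iz})`, to be used only for `Im z < 0`, where `|e^{-2iz}| < 1`. -/
def f₀ (z : ℂ) : ℂ :=
  Complex.I / 6 * z ^ 3 + 1 / 4 * li3 (Complex.exp (-2 * Complex.I * z))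

/-- `IsBranchAt f z`: near `z`, the function `f` is a branch of the multivalued analytic function
obtained from `f₀` on the lower half-plane by analytic continuation. -/
inductive IsBranchAt : (ℂ → ℂ) → ℂ → Prop
  | base (z : ℂ) (hz : z.im < 0) : IsBranchAt f₀ z
  | continuation (f : ℂ → ℂ) (U : Set ℂ) (z w : ℂ) (hU : IsOpen U) (hU' : IsPreconnected U)
      (hf : AnalyticOnNhd ℂ f U) (hz : z ∈ U) (hw : w ∈ U) (h : IsBranchAt f z) : IsBranchAt f w
  | congr (f g : ℂ → ℂ) (z : ℂ) (hfg : f =ᶠ[𝓝 z] g) (h : IsBranchAt f z) : IsBranchAt g z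

/-! The WDVV equations in coordinates `x_1, …, x_N, x_{N+1} = y`. -/

section WDVV

/-- The partial derivative `∂F/∂x_i`. -/
def pd {n : ℕ} (i : Fin n) (F : (Fin n → ℂ) → ℂ) (X : Fin n → ℂ) : ℂ :=
  fderiv ℂ F X (Pi.single i 1)

/-- The matrix `F_i` of third derivatives `∂³F/∂x_i∂x_p∂x_q` at the point `X`. -/
def thirdDeriv {n : ℕ} (F : (Fin n → ℂ) → ℂ) (X : Fin n → ℂ) (i : Fin n) :
    Matrix (Fin n) (Fin n) ℂ :=
  Matrix.of fun p q => pd i (pd p (pd q F)) X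

/-- At `X` the function `F` is holomorphic, the matrix `F_{N+1}` is invertible, and the equations
`F_i F_{N+1}⁻¹ F_j = F_j F_{N+1}⁻¹ F_i` hold for `i, j = 1, …, N`. -/
def SolvesWDVVAt {N : ℕ} (F : (Fin (N + 1) → ℂ) → ℂ) (X : Fin (N + 1) → ℂ) : Prop :=
  AnalyticAt ℂ F X ∧ IsUnit (thirdDeriv F X (Fin.last N)).det ∧
  ∀ i j : Fin N,
    thirdDeriv F X i.castSucc * (thirdDeriv F X (Fin.last N))⁻¹ * thirdDeriv F X j.castSucc =
    thirdDeriv F X j.castSucc * (thirdDeriv F X (Fin.last N))⁻¹ * thirdDeriv F X i.castSucc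

/-- `F(x, y) = y³/3 + ∑ c_α α(x)² y + λ ∑ c_α f(α(x))`, where `X = (x, y)`. -/
def prepotential {N : ℕ} {κ : Type*} [Fintype κ] (α : κ → Dual ℂ (Fin N → ℂ)) (c : κ → ℂ)
    (lam : ℂ) (f : ℂ → ℂ) (X : Fin (N + 1) → ℂ) : ℂ :=
  1 / 3 * X (Fin.last N) ^ 3 + (∑ k, c k * α k (Fin.init X) ^ 2) * X (Fin.last N) +
    lam * ∑ k, c k * f (α k (Fin.init X))

/-- For every choice of a branch `f`, the prepotential solves the WDVV equations at every point
`(x, y)` at which the branch is defined at all `α(x)`. -/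
def PrepotentialSolvesWDVV {N : ℕ} {κ : Type*} [Fintype κ] (α : κ → Dual ℂ (Fin N → ℂ))
    (c : κ → ℂ) (lam : ℂ) : Prop :=
  ∀ (f : ℂ → ℂ) (X : Fin (N + 1) → ℂ), (∀ k, IsBranchAt f (α k (Fin.init X))) →
    SolvesWDVVAt (prepotential α c lam f) X

end WDVV

/-! Restrictions of root systems. -/

open Classical in
/-- The configuration `(α, c)` in `V` is, up to a linear isomorphism, a restriction of a root
system. There are a finite crystallographic root system `P` (not necessarily reduced or
irreducible) with a Weyl-invariant multiplicity function `m`, a subsystem `B` cut out by a linear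
subspace, and a linear isomorphism `ψ` of `V` onto the common kernel of the roots in `B` such that
the non-zero restrictions of the positive roots, with added multiplicities, give the configuration
up to the signs of the covectors. Since `m` is even, the total multiplicity of the positive roots
that restrict to `ξ` or `-ξ` is the total multiplicity of all roots that restrict to `ξ`. Covectors
of multiplicity zero are disregarded. -/
def IsRestrictionOfRootSystem {V : Type*} [AddCommGroup V] [Module ℂ V] {κ : Type*} [Fintype κ]
    (α : κ → Dual ℂ V) (c : κ → ℂ) : Prop :=
  ∃ (ι M N : Type) (_ : Fintype ι) (_ : AddCommGroup M) (_ : Module ℂ M) (_ : AddCommGroup N)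
    (_ : Module ℂ N) (P : RootPairing ι ℂ M N) (m : ι → ℂ) (B : Set ι) (ψ : V →ₗ[ℂ] N),
    P.IsRootSystem ∧ P.IsCrystallographic ∧
    (∀ i j, m (P.reflectionPerm i j) = m j) ∧
    (∀ i, P.root i ∈ Submodule.span ℂ (P.root '' B) → i ∈ B) ∧
    Function.Injective ψ ∧ Set.range ψ = {x | ∀ i ∈ B, P.root' i x = 0} ∧
    ∀ ξ : Dual ℂ V, ξ ≠ 0 →
      ∑ i with P.root' i ∘ₗ ψ = ξ, m i = ∑ k with α k = ξ ∨ α k = -ξ, c k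

/-! The four-dimensional configuration. -/

/-- Index set of the covectors `e^i` (`i ≤ 3`), `e^4`, `e^i ± e^j` (`i < j ≤ 3`) and
`(e^1 ± e^2 ± e^3 ± e^4)/2`, in this order. -/
abbrev Idx : Type :=
  Fin 3 ⊕ Unit ⊕ ({ij : Fin 3 × Fin 3 // ij.1 < ij.2} × ℤˣ) ⊕ (Fin 3 → ℤˣ)

/-- The coordinate covectors of `ℂ^4`. -/
def e (i : Fin 4) : Dual ℂ (Fin 4 → ℂ) := LinearMap.proj i

def cov : Idx → Dual ℂ (Fin 4 → ℂ)
  | .inl i => e i.castSucc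
  | .inr (.inl _) => e 3
  | .inr (.inr (.inl (ij, ε))) => e ij.1.1.castSucc + (ε : ℤ) • e ij.1.2.castSucc
  | .inr (.inr (.inr ε)) => (1 / 2 : ℂ) • (e 0 + ∑ k : Fin 3, (ε k : ℤ) • e k.succ)

def mult (p q r s : ℂ) : Idx → ℂ
  | .inl _ => p
  | .inr (.inl _) => q
  | .inr (.inr (.inl _)) => r
  | .inr (.inr (.inr _)) => s

end

end TrigVee

namespace TrigVee

noncomputable section

/-! Bilinear forms invariant under the Weyl group and their restrictions. -/

/-! Both halves rest on `G` being diagonal, with entries 3p, 3p, 3p and 3sp/(4r+s) (`gram_eq`).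
Hence 12p c_β α(β^∨) is a linear form in r and s with integer coefficients, and the vee-conditions
become finitely many integer identities (`sum_series_weight`).

For WDVV, every branch satisfies f''' = cot, by the identity theorem
(`IsBranchAt.analyticAt_and_eventually`). F_5 is constant and diagonal, so the equations reduce to
one identity between a contraction of the cubic tensor ∑ c_α cot α(x) α⊗α⊗α with itself and a
constant tensor (`solvesWDVVAt_prepotential`). The contraction is a sum over pairs of covectors of
c_a c_b a(b^∨) (a∧b)⊗(a∧b) cot a(x) cot b(x), up to a factor (`sum_contraction`). Each coefficient
splits into contributions of the linear relations a ± b ± c = 0, with a weight common to the three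
pairs of a relation up to sign (`quadWeight_eq`), and (a∧b)⊗(a∧b) is the same for these three pairs.
The addition law of the cotangent then makes the sum independent of x, so every cotangent may be
replaced by i, which satisfies the same relations (`sum_minor_mul_evalQuad`). What remains is an
identity in r and s that fixes λ².

For (2), the component v of a coroot in the restricted space represents the restricted root, up to a
scalar, for all invariant forms at once (`exists_restricted_coroot`). An additive map φ : ℂ → ℂ
turns invariant multiplicities into invariant ones, and v does not change. With g_i the diagonal
entries of `G`, the covector (1,1,1,1)/2 forces g_i v_i and φ(g_i) v_i to be independent of i. If
g_1/g_4 = 4r/s + 1 is irrational, some φ has φ(g_1) = 1 and φ(g_4) = 0, whence v = 0, a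
contradiction. -/

theorem form_apply {V κ : Type*} [AddCommGroup V] [Module ℂ V] [Fintype κ]
    (α : κ → Dual ℂ V) (c : κ → ℂ) (u v : V) :
    form α c u v = ∑ k, c k * (α k u * α k v) := by
  simp [form, LinearMap.sum_apply]

section Restriction

variable {ι M N : Type*} [Fintype ι] [AddCommGroup M] [Module ℂ M] [AddCommGroup N] [Module ℂ N]
  (P : RootPairing ι ℂ M N)

theorem form_coreflection {m : ι → ℂ} (hm : ∀ i j, m (P.reflectionPerm i j) = m j) (i : ι)
    (x y : N) :
    form P.root' m (P.coreflection i x) (P.coreflection i y) = form P.root' m x y := by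
  have h (j : ι) (z : N) : P.root' j (P.coreflection i z) = P.root' (P.reflectionPerm i j) z :=
    P.flip.coroot'_reflection z
  simp only [form_apply, h]
  rw [← Equiv.sum_comp (P.reflectionPerm i) fun j => m j * (P.root' j x * P.root' j y)]
  simp only [hm]

/-- The reflection negates its own coroot, so invariance alone makes the coroot represent a multiple
of the root. The multiple may vanish for a complex `m`. -/
theorem two_mul_form_coroot {m : ι → ℂ} (hm : ∀ i j, m (P.reflectionPerm i j) = m j) (i : ι)
    (y : N) :
    2 * form P.root' m (P.coroot i) y
      = form P.root' m (P.coroot i) (P.coroot i) * P.root' i y := by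
  have h := form_coreflection P hm i (P.coroot i) y
  rw [P.coreflection_apply_self, P.coreflection_apply] at h
  simp only [map_neg, LinearMap.neg_apply, map_sub, map_smul, smul_eq_mul] at h
  linear_combination -h

variable {V : Type*} [AddCommGroup V] [Module ℂ V]

-- Grouping the roots by their restriction ξ turns the sum into one over covectors; the fibre ξ = 0
-- contributes nothing. The factor 2 appears because each `α k` is met both as ξ and as -ξ.
open Classical in
theorem form_comp_restriction {κ : Type*} [Fintype κ] {α : κ → Dual ℂ V} {c : κ → ℂ}
    {m : ι → ℂ} {ψ : V →ₗ[ℂ] N} (hα : ∀ k, α k ≠ 0)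
    (h : ∀ ξ : Dual ℂ V, ξ ≠ 0 →
      ∑ i with P.root' i ∘ₗ ψ = ξ, m i = ∑ k with α k = ξ ∨ α k = -ξ, c k) (u v : V) :
    form P.root' m (ψ u) (ψ v) = 2 * form α c u v := by
  set S : Finset (Dual ℂ V) := (Finset.univ.image fun i => P.root' i ∘ₗ ψ) ∪
    (Finset.univ.image α ∪ Finset.univ.image fun k => -α k) with hS
  have h1 : form P.root' m (ψ u) (ψ v)
      = ∑ ξ ∈ S, (∑ i with P.root' i ∘ₗ ψ = ξ, m i) * (ξ u * ξ v) := by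
    rw [form_apply, ← Finset.sum_fiberwise_of_maps_to (s := Finset.univ) (t := S)
      (g := fun i => P.root' i ∘ₗ ψ) (by intro i _; simp [hS])]
    refine Finset.sum_congr rfl fun ξ _ => ?_
    rw [Finset.sum_mul]
    refine Finset.sum_congr rfl fun i hi => ?_
    obtain rfl := (Finset.mem_filter.1 hi).2
    rfl
  have h2 : ∑ ξ ∈ S, (∑ i with P.root' i ∘ₗ ψ = ξ, m i) * (ξ u * ξ v)
      = ∑ ξ ∈ S, (∑ k with α k = ξ ∨ α k = -ξ, c k) * (ξ u * ξ v) := by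
    refine Finset.sum_congr rfl fun ξ _ => ?_
    by_cases hξ : ξ = 0
    · simp [hξ]
    · rw [h ξ hξ]
  have h3 (k : κ) : ∑ ξ ∈ S, (if α k = ξ ∨ α k = -ξ then c k else 0) * (ξ u * ξ v)
      = 2 * (c k * (α k u * α k v)) := by
    have hne : α k ≠ -α k := fun h => hα k (by
      rw [eq_neg_iff_add_eq_zero, ← two_smul ℂ] at h
      simpa using h)
    rw [← Finset.sum_subset (s₁ := {α k, -α k})]
    · rw [Finset.sum_pair hne]
      simp
      ring
    · intro ξ hξ
      simp only [Finset.mem_insert, Finset.mem_singleton] at hξ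
      simp only [hS, Finset.mem_union, Finset.mem_image, Finset.mem_univ, true_and]
      rcases hξ with rfl | rfl
      · exact Or.inr (Or.inl ⟨k, rfl⟩)
      · exact Or.inr (Or.inr ⟨k, rfl⟩)
    · intro ξ _ hξ
      rw [if_neg, zero_mul]
      rintro (h | h) <;> simp [h] at hξ
  rw [h1, h2, form_apply, Finset.mul_sum, ← Finset.sum_congr rfl fun k _ => h3 k,
    Finset.sum_comm]
  refine Finset.sum_congr rfl fun ξ _ => ?_
  rw [Finset.sum_filter, Finset.sum_mul]

/-- The canonical form plays a separate role from a general invariant form: its value on a coroot is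
never zero, so the relation can be solved for the root. -/
theorem two_mul_corootForm_coroot (i : ι) (y : N) :
    2 * P.CorootForm (P.coroot i) y
      = P.CorootForm (P.coroot i) (P.coroot i) * P.root' i y := by
  have h := congrArg (fun x => P.toLinearMap x y) (P.corootForm_self_smul_root i)
  simp only [map_smul, LinearMap.smul_apply, smul_eq_mul, two_nsmul, map_add,
    LinearMap.add_apply, P.toLinearMap_apply_CoPolarization] at h
  rw [two_mul, ← h]

variable [P.IsRootSystem] [P.IsCrystallographic]

/-- If an invariant form is non-degenerate on the common kernel `ψ(V)` of the roots in `B`, then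
`ψ(V)` and the coroots of the roots in `B` span the whole space. -/
theorem exists_add_mem_span_coroot {m : ι → ℂ} (hm : ∀ i j, m (P.reflectionPerm i j) = m j)
    {B : Set ι} {ψ : V →ₗ[ℂ] N} (hψ : Set.range ψ = {x | ∀ i ∈ B, P.root' i x = 0})
    (hsep : ∀ v, (∀ w, form P.root' m (ψ v) (ψ w) = 0) → ψ v = 0) (y : N) :
    ∃ v, ∃ u ∈ Submodule.span ℂ (P.coroot '' B), y = ψ v + u := by
  have hfin : FiniteDimensional ℂ N :=
    Module.finite_def.2 (by
      rw [← RootPairing.IsRootSystem.span_coroot_eq_top (P := P)]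
      exact Submodule.fg_span (Set.finite_range _))
  set U := Submodule.span ℂ (P.coroot '' B)
  have hrange (x : N) (hx : x ∈ P.CorootForm.orthogonal U) : ∃ v, ψ v = x := by
    change x ∈ Set.range ψ
    rw [hψ]
    intro i hi
    have h := two_mul_corootForm_coroot P i x
    rw [hx _ (Submodule.subset_span ⟨i, hi, rfl⟩), mul_zero] at h
    exact (mul_eq_zero.1 h.symm).resolve_left
      (RootPairing.IsAnisotropic.corootForm_coroot_ne_zero i)
  -- Disjointness comes from the form of `m`: the coroots of `B` are orthogonal to ψ(V) for it, and
  -- it is non-degenerate on ψ(V).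
  have hdisj : Disjoint U (P.CorootForm.orthogonal U) := by
    rw [Submodule.disjoint_def]
    intro x hxU hx
    obtain ⟨v, rfl⟩ := hrange x hx
    refine hsep v fun w => ?_
    have hw : ∀ i ∈ B, P.root' i (ψ w) = 0 := by
      have : ψ w ∈ Set.range ψ := ⟨w, rfl⟩
      rwa [hψ] at this
    have : U ≤ LinearMap.ker ((form P.root' m).flip (ψ w)) := by
      rw [Submodule.span_le]
      rintro _ ⟨i, hi, rfl⟩
      have h := two_mul_form_coroot P hm i (ψ w)
      rw [hw i hi, mul_zero] at h
      simpa using h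
    simpa using this hxU
  have hc : IsCompl U (P.CorootForm.orthogonal U) := (LinearMap.BilinForm.isCompl_orthogonal_iff_disjoint
    P.flip.rootForm_symmetric.isRefl).2 hdisj
  have hy : y ∈ U ⊔ P.CorootForm.orthogonal U := by
    rw [hc.sup_eq_top]
    trivial
  obtain ⟨u, hu, x, hx, rfl⟩ := Submodule.mem_sup.1 hy
  obtain ⟨v, rfl⟩ := hrange x hx
  exact ⟨v, u, hu, add_comm _ _⟩

/-- The restriction of a root to `ψ(V)` is represented, up to scalars, by one and the same vector
for all invariant forms. -/
theorem exists_restricted_coroot {m : ι → ℂ} (hm : ∀ i j, m (P.reflectionPerm i j) = m j)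
    {B : Set ι} {ψ : V →ₗ[ℂ] N} (hψ : Set.range ψ = {x | ∀ i ∈ B, P.root' i x = 0})
    (hsep : ∀ v, (∀ w, form P.root' m (ψ v) (ψ w) = 0) → ψ v = 0) (i : ι)
    (hi : P.root' i ∘ₗ ψ ≠ 0) :
    ∃ v ≠ 0, ∀ m' : ι → ℂ, (∀ i j, m' (P.reflectionPerm i j) = m' j) →
      ∃ g, ∀ w, form P.root' m' (ψ v) (ψ w) = g * P.root' i (ψ w) := by
  obtain ⟨v, u, hu, huv⟩ := exists_add_mem_span_coroot P hm hψ hsep (P.coroot i)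
  have key (m' : ι → ℂ) (hm' : ∀ i j, m' (P.reflectionPerm i j) = m' j) :
      ∀ w, form P.root' m' (ψ v) (ψ w)
        = form P.root' m' (P.coroot i) (P.coroot i) / 2 * P.root' i (ψ w) := by
    intro w
    have hw : ∀ i ∈ B, P.root' i (ψ w) = 0 := by
      have : ψ w ∈ Set.range ψ := ⟨w, rfl⟩
      rwa [hψ] at this
    have hle : Submodule.span ℂ (P.coroot '' B)
        ≤ LinearMap.ker ((form P.root' m').flip (ψ w)) := by
      rw [Submodule.span_le]
      rintro _ ⟨j, hj, rfl⟩
      have h := two_mul_form_coroot P hm' j (ψ w)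
      rw [hw j hj, mul_zero] at h
      simpa using h
    have hu0 : form P.root' m' u (ψ w) = 0 := by simpa using hle hu
    have h := two_mul_form_coroot P hm' i (ψ w)
    have h2 : form P.root' m' (P.coroot i) (ψ w) = form P.root' m' (ψ v) (ψ w) := by
      rw [huv, map_add, LinearMap.add_apply, hu0, add_zero]
    rw [← h2]
    linear_combination h / 2
  refine ⟨v, ?_, fun m' hm' => ⟨_, key m' hm'⟩⟩
  -- If v = 0, the canonical form (all multiplicities 1) shows that the root vanishes on ψ(V), since
  -- its value on the coroot is not zero.
  rintro rfl
  apply hi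
  ext w
  have hK : form P.root' 1 = P.CorootForm := by
    ext x y
    simp [form_apply, P.corootForm_apply_apply]
  have h := key 1 fun _ _ => rfl
  simp only [map_zero, LinearMap.zero_apply, hK] at h
  simpa [RootPairing.IsAnisotropic.corootForm_coroot_ne_zero (P := P) i] using h w

end Restriction

-- Additivity of φ is all that is needed to pass from `m` to φ ∘ `m`: invariance persists, and so do
-- the sums over fibres. The condition `hk` guarantees that `α k` really is the restriction of some
-- root.
open Classical in
theorem IsRestrictionOfRootSystem.exists_dual_vector {V : Type*} [AddCommGroup V] [Module ℂ V]
    {κ : Type*} [Fintype κ] {α : κ → Dual ℂ V} {c : κ → ℂ}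
    (h : IsRestrictionOfRootSystem α c) (hα : ∀ k, α k ≠ 0)
    (hsep : ∀ v, (∀ w, form α c v w = 0) → v = 0) {k : κ}
    (hk : ∑ l with α l = α k ∨ α l = -α k, c l ≠ 0) :
    ∃ v ≠ 0, ∀ φ : ℂ →+ ℂ, ∃ g, ∀ w, form α (fun l => φ (c l)) v w = g * α k w := by
  obtain ⟨ι, M, N, _, _, _, _, _, P, m, B, ψ, _, _, hm, -, -, hψ, hs⟩ := h
  have hform := form_comp_restriction P hα hs
  obtain ⟨i, hi, -⟩ := Finset.exists_ne_zero_of_sum_ne_zero ((hs _ (hα k)).trans_ne hk)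
  replace hi : P.root' i ∘ₗ ψ = α k := by simpa using hi
  obtain ⟨v, hv, H⟩ := exists_restricted_coroot P hm hψ
    (fun v hv => by
      have : v = 0 := hsep v fun w => by simpa [hform] using hv w
      rw [this, map_zero]) i (hi ▸ hα k)
  refine ⟨v, hv, fun φ => ?_⟩
  obtain ⟨g, hg⟩ := H (fun j => φ (m j)) fun i j => by rw [hm]
  refine ⟨g / 2, fun w => ?_⟩
  have hform' := form_comp_restriction P (ψ := ψ) (m := fun j => φ (m j)) (c := fun l => φ (c l)) hα
    (fun ξ hξ => by simp only [← map_sum, hs ξ hξ]) v w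
  rw [hg w] at hform'
  rw [← hi, LinearMap.comp_apply]
  linear_combination -hform' / 2

/-- The hypothesis says that a lies outside the line ℚb, so a ℚ-linear functional on ℂ kills b but
not a; it is then rescaled. -/
theorem exists_addMonoidHom_apply_eq_one_and_eq_zero {a b : ℂ}
    (h : ∀ t : ℚ, (t : ℂ) * b ≠ a) : ∃ φ : ℂ →+ ℂ, φ a = 1 ∧ φ b = 0 := by
  obtain ⟨f, hf, hle⟩ := Submodule.exists_le_ker_of_notMem (K := ℚ) (p := Submodule.span ℚ {b})
    (v := a) (by
      rw [Submodule.mem_span_singleton]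
      rintro ⟨t, ht⟩
      exact h t (by rw [← ht, Rat.smul_def]))
  have hb : f b = 0 := hle (Submodule.mem_span_singleton_self b)
  exact ⟨(algebraMap ℚ ℂ : ℚ →+ ℂ).comp ((f a)⁻¹ • f).toAddMonoidHom, by simp [hf], by simp [hb]⟩

/-! The configuration in coordinates. -/

set_option synthInstance.maxSize 1000 in
instance : DecidableEq Idx := inferInstance

/-- The coordinates of the covectors, multiplied by two. -/
def dcov : Idx → Fin 4 → ℤ
  | .inl i => Pi.single i.castSucc 2
  | .inr (.inl _) => Pi.single 3 2
  | .inr (.inr (.inl (ij, ε))) =>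
    Pi.single ij.1.1.castSucc 2 + Pi.single ij.1.2.castSucc (2 * (ε : ℤ))
  | .inr (.inr (.inr ε)) => Fin.cons 1 fun k => (ε k : ℤ)

theorem cov_apply (k : Idx) (x : Fin 4 → ℂ) : cov k x = 1 / 2 * ∑ i, (dcov k i : ℂ) * x i := by
  have hs (i : Fin 4) (a : ℤ) : ∑ j, ((Pi.single i a : Fin 4 → ℤ) j : ℂ) * x j = a * x i := by
    rw [Finset.sum_eq_single i]
    · simp
    · intro j _ hj
      simp [hj]
    · simp
  rcases k with i | _ | ⟨ij, ε⟩ | ε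
  · simp only [cov, dcov, hs, e, LinearMap.proj_apply]
    push_cast
    ring
  · simp only [cov, dcov, hs, e, LinearMap.proj_apply]
    push_cast
    ring
  · simp only [cov, dcov, Pi.add_apply, Int.cast_add, add_mul, Finset.sum_add_distrib, hs, e,
      LinearMap.add_apply, LinearMap.smul_apply, LinearMap.proj_apply, zsmul_eq_mul]
    push_cast
    ring
  · simp [cov, dcov, e, Fin.sum_univ_succ]
    ring

theorem cov_single (k : Idx) (i : Fin 4) : cov k (Pi.single i 1) = (dcov k i : ℂ) / 2 := by
  rw [cov_apply, Finset.sum_eq_single i]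
  · simp
    ring
  · intro j _ hj
    simp [hj]
  · simp

theorem sum_idx {A : Type*} [AddCommMonoid A] (f : Idx → A) :
    ∑ k, f k = ∑ i, f (.inl i) + (f (.inr (.inl ()))
      + (∑ x, f (.inr (.inr (.inl x))) + ∑ ε, f (.inr (.inr (.inr ε))))) := by
  simp [Fintype.sum_sum_type]

set_option maxRecDepth 100000 in
theorem sum_dcov_mul (i j : Fin 4) :
    ∑ k, dcov (.inl k) i * dcov (.inl k) j = (if i = j ∧ i ≠ 3 then 4 else 0) ∧
    dcov (.inr (.inl ())) i * dcov (.inr (.inl ())) j = (if i = j ∧ i = 3 then 4 else 0) ∧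
    ∑ x, dcov (.inr (.inr (.inl x))) i * dcov (.inr (.inr (.inl x))) j
      = (if i = j ∧ i ≠ 3 then 16 else 0) ∧
    ∑ ε, dcov (.inr (.inr (.inr ε))) i * dcov (.inr (.inr (.inr ε))) j
      = (if i = j then 8 else 0) := by
  revert i j
  decide +kernel

/-- The diagonal entries of `G` in the coordinates of `ℂ^4`. -/
def gram (p q r s : ℂ) (i : Fin 4) : ℂ := if i = 3 then q + 2 * s else p + 4 * r + 2 * s

theorem sum_mult_mul_dcov (p q r s : ℂ) (i j : Fin 4) :
    ∑ k, mult p q r s k * ((dcov k i : ℂ) * dcov k j) =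
      if i = j then 4 * gram p q r s i else 0 := by
  obtain ⟨h1, h2, h3, h4⟩ := sum_dcov_mul i j
  rw [← @Int.cast_inj ℂ] at h1 h2 h3 h4
  push_cast at h1 h2 h3 h4
  rw [sum_idx]
  simp only [mult, ← Finset.mul_sum, h1, h2, h3, h4, gram]
  by_cases hij : i = j
  · subst hij
    by_cases hi : i = 3
    · simp only [hi, ne_eq, not_true_eq_false, and_false, and_self, if_true, if_false]
      ring
    · simp only [hi, ne_eq, not_false_eq_true, and_false, and_self, if_true, if_false]
      ring
  · simp [hij]

theorem form_cov_apply (p q r s : ℂ) (u v : Fin 4 → ℂ) :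
    form cov (mult p q r s) u v = ∑ i, gram p q r s i * (u i * v i) := by
  have h (k : Idx) : mult p q r s k * (cov k u * cov k v)
      = ∑ i, ∑ j, 1 / 4 * (u i * v j) * (mult p q r s k * ((dcov k i : ℂ) * dcov k j)) := by
    rw [cov_apply, cov_apply, mul_mul_mul_comm, Finset.sum_mul_sum, Finset.mul_sum, Finset.mul_sum]
    refine Finset.sum_congr rfl fun i _ => ?_
    rw [Finset.mul_sum, Finset.mul_sum]
    exact Finset.sum_congr rfl fun j _ => by ring
  rw [form_apply, Finset.sum_congr rfl fun k _ => h k, Finset.sum_comm]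
  refine Finset.sum_congr rfl fun i _ => ?_
  rw [Finset.sum_comm, Finset.sum_eq_single i]
  · rw [← Finset.mul_sum, sum_mult_mul_dcov, if_pos rfl]
    ring
  · intro j _ hj
    rw [← Finset.mul_sum, sum_mult_mul_dcov, if_neg hj.symm, mul_zero]
  · simp

set_option maxRecDepth 100000 in
theorem dcov_eq_or_neg {k l : Idx} (h : dcov l = dcov k ∨ dcov l = -dcov k) : l = k := by
  have H : ∀ k l, dcov l = dcov k ∨ dcov l = -dcov k → l = k := by decide +kernel
  exact H k l h

theorem cov_injective_up_to_sign {k l : Idx} : cov l = cov k ∨ cov l = -cov k ↔ l = k := by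
  refine ⟨fun h => dcov_eq_or_neg ?_, fun h => Or.inl (h ▸ rfl)⟩
  refine h.imp (fun h => ?_) fun h => ?_ <;> ext i <;>
    have := LinearMap.congr_fun h (Pi.single i 1) <;>
    simp only [LinearMap.neg_apply, cov_single] at this
  · have := mul_right_cancel₀ (b := (2 : ℂ)⁻¹) (by norm_num) this
    exact_mod_cast this
  · rw [← neg_div] at this
    have := mul_right_cancel₀ (b := (2 : ℂ)⁻¹) (by norm_num) this
    rw [Pi.neg_apply]
    exact_mod_cast this

theorem cov_ne_zero (k : Idx) : cov k ≠ 0 := by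
  intro h
  have h1 : dcov k = -dcov k := by
    ext i
    have := LinearMap.congr_fun h (Pi.single i 1)
    rw [cov_single] at this
    simp at this
    simp [this]
  have h2 : ∀ k, dcov k ≠ -dcov k := by decide +kernel
  exact h2 k h1

/-! ### The Gram matrix and the obstruction to being a restriction. -/

theorem gram_eq {p q r s : ℂ} (h : 4 * r + s ≠ 0) (hp : p = 2 * r + s)
    (hq : q = s * (s - 2 * r) / (4 * r + s)) (i : Fin 4) :
    gram p q r s i = if i = 3 then 3 * s * p / (4 * r + s) else 3 * p := by
  subst hp hq
  unfold gram
  split_ifs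
  · rw [eq_div_iff h, add_mul, div_mul_cancel₀ _ h]
    ring
  · ring

theorem form_cov_single (p q r s : ℂ) (u : Fin 4 → ℂ) (i : Fin 4) :
    form cov (mult p q r s) u (Pi.single i 1) = gram p q r s i * u i := by
  rw [form_cov_apply, Finset.sum_eq_single i]
  · simp
  · intro j _ hj
    simp [hj]
  · simp

theorem gram_ne_zero {p q r s : ℂ} (h : 4 * r + s ≠ 0) (hp : p = 2 * r + s)
    (hq : q = s * (s - 2 * r) / (4 * r + s)) (hps : p * s ≠ 0) (i : Fin 4) :
    gram p q r s i ≠ 0 := by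
  have hp0 : p ≠ 0 := left_ne_zero_of_mul hps
  have hs0 : s ≠ 0 := right_ne_zero_of_mul hps
  rw [gram_eq h hp hq]
  split_ifs
  · exact div_ne_zero (mul_ne_zero (mul_ne_zero three_ne_zero hs0) hp0) h
  · exact mul_ne_zero three_ne_zero hp0

theorem not_isRestrictionOfRootSystem {p q r s : ℂ} (h : 4 * r + s ≠ 0) (hp : p = 2 * r + s)
    (hq : q = s * (s - 2 * r) / (4 * r + s)) (hps : p * s ≠ 0)
    (hrat : ∀ t : ℚ, 4 * (r / s) + 1 ≠ t) :
    ¬ IsRestrictionOfRootSystem cov (mult p q r s) := by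
  intro H
  have hp0 : p ≠ 0 := left_ne_zero_of_mul hps
  have hs0 : s ≠ 0 := right_ne_zero_of_mul hps
  have hg := gram_eq h hp hq
  have hg0 := gram_ne_zero h hp hq hps
  -- The covector (1,1,1,1)/2 has equal coordinates, so it compares all diagonal entries of `G`.
  set k : Idx := .inr (.inr (.inr 1)) with hk
  obtain ⟨v, hv, hφ⟩ := H.exists_dual_vector cov_ne_zero (k := k) (fun v hv => by
      ext i
      have := hv (Pi.single i 1)
      rw [form_cov_single] at this
      simpa [hg0 i] using this) (by
      simp only [cov_injective_up_to_sign, Finset.sum_filter]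
      simpa [hk, mult] using hs0)
  have hkcov (i : Fin 4) : cov k (Pi.single i 1) = 1 / 2 := by
    rw [cov_single]
    refine Fin.cases ?_ (fun j => ?_) i <;> simp [hk, dcov]
  -- The ratio of the two distinct diagonal entries is 4r/s + 1, which is irrational by `hrat`.
  obtain ⟨φ, h1, h0⟩ := exists_addMonoidHom_apply_eq_one_and_eq_zero
    (a := gram p q r s 0) (b := gram p q r s 3) (fun t ht => hrat t (by
      simp only [hg] at ht
      simp at ht
      have : (t : ℂ) * (3 * s * p) = 3 * p * (4 * r + s) := by
        rw [← ht]
        field_simp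
      have h2 : (t : ℂ) * s = 4 * r + s := by
        apply mul_left_cancel₀ (mul_ne_zero three_ne_zero hp0)
        linear_combination this
      field_simp
      linear_combination -h2))
  have hφmult : (fun l => φ (mult p q r s l)) = mult (φ p) (φ q) (φ r) (φ s) := by
    ext l
    rcases l with i | _ | ⟨ij, ε⟩ | ε <;> rfl
  -- φ is only additive, but `gram` is an integer combination of the multiplicities.
  have hφgram (i) : gram (φ p) (φ q) (φ r) (φ s) i = φ (gram p q r s i) := by
    have h2 (z : ℂ) : φ (2 * z) = 2 * φ z := by rw [two_mul, map_add, two_mul]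
    have h4 (z : ℂ) : φ (4 * z) = 4 * φ z := by
      rw [show 4 * z = 2 * (2 * z) by ring, h2, h2]
      ring
    unfold gram
    split_ifs <;> simp [h2, h4]
  obtain ⟨g, hg1⟩ := hφ (AddMonoidHom.id ℂ)
  obtain ⟨g', hg2⟩ := hφ φ
  have e1 (i : Fin 4) : gram p q r s i * v i = g / 2 := by
    rw [← form_cov_single, div_eq_mul_one_div, ← hkcov i]
    exact hg1 _
  have e2 (i : Fin 4) : φ (gram p q r s i) * v i = g' / 2 := by
    rw [← hφgram, ← form_cov_single, div_eq_mul_one_div, ← hkcov i, ← hφmult]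
    exact hg2 _
  have e3 := e2 3
  rw [h0, zero_mul] at e3
  have e4 := e2 0
  rw [h1, one_mul, ← e3] at e4
  have e5 := e1 0
  rw [e4, mul_zero] at e5
  apply hv
  ext i
  have := e1 i
  rw [← e5] at this
  simpa [hg0 i] using this

/-! The configuration is a trigonometric vee-system. -/

/-- The coefficients of `r` and `s` in the two parts of `weight`. -/
def weightCoeff : Idx → (ℤ × ℤ) × (ℤ × ℤ)
  | .inl _ => ((2, 1), (0, 0))
  | .inr (.inl _) => ((0, 0), (-2, 1))
  | .inr (.inr (.inl _)) => ((1, 0), (0, 0))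
  | .inr (.inr (.inr _)) => ((0, 1), (4, 1))

/-- The coefficients of `r` and `s` in `12 p c_j α_i(α_j^∨)`. -/
def weight (i j : Idx) : ℤ × ℤ :=
  (dcov i 0 * dcov j 0 + dcov i 1 * dcov j 1 + dcov i 2 * dcov j 2) • (weightCoeff j).1 +
    (dcov i 3 * dcov j 3) • (weightCoeff j).2

/-- The denominators cancel because the factor (4r+s)/s occurs only with the fourth coordinate.
There the multiplicity is q or s, and q(4r+s)/s = s - 2r, s(4r+s)/s = 4r + s; the other covectors
have fourth coordinate 0. -/
theorem mult_mul_sum_div_gram {p q r s : ℂ} (h : 4 * r + s ≠ 0) (hp : p = 2 * r + s)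
    (hq : q = s * (s - 2 * r) / (4 * r + s)) (hps : p * s ≠ 0) (i j : Idx) :
    mult p q r s j * ∑ a, (dcov i a : ℂ) * dcov j a / gram p q r s a
      = ((weight i j).1 * r + (weight i j).2 * s) / (3 * p) := by
  have hp0 : p ≠ 0 := left_ne_zero_of_mul hps
  have hs0 : s ≠ 0 := right_ne_zero_of_mul hps
  have hsum : ∑ a, (dcov i a : ℂ) * dcov j a / gram p q r s a
      = ((dcov i 0 * dcov j 0 + dcov i 1 * dcov j 1 + dcov i 2 * dcov j 2)
        + dcov i 3 * dcov j 3 * ((4 * r + s) / s)) / (3 * p) := by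
    simp only [Fin.sum_univ_four, gram_eq h hp hq]
    simp
    field_simp
  rw [hsum, ← mul_div_assoc]
  congr 1
  rcases j with j | _ | ⟨ij, ε⟩ | ε <;> simp only [weight, weightCoeff, mult]
  · have : ∀ x, dcov (.inl x) 3 = 0 := by decide
    simp [this, hp]
    ring
  · have h0 : dcov (.inr (.inl ())) 0 = 0 ∧ dcov (.inr (.inl ())) 1 = 0 ∧
      dcov (.inr (.inl ())) 2 = 0 := by decide
    have hq' : q * ((4 * r + s) / s) = s - 2 * r := by
      rw [hq, div_mul_div_cancel₀ h, mul_div_cancel_left₀ _ hs0]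
    simp [h0]
    linear_combination (dcov i 3 : ℂ) * dcov (.inr (.inl ())) 3 * hq'
  · have : ∀ x, dcov (.inr (.inr (.inl x))) 3 = 0 := by decide +kernel
    simp [this]
    ring
  · simp
    field_simp
    ring

/-- The entries of a small integer vector, encoded as the digits of an integer. -/
def encode (x : Fin 4 → ℤ) : ℤ := x 0 + 64 * (x 1 + 64 * (x 2 + 64 * x 3))

/-- The integer `y` is a small multiple of `x`. -/
def IsSmallMultiple (x y : ℤ) : Prop := y = y / x * x ∧ |y / x| ≤ 4

instance (x y : ℤ) : Decidable (IsSmallMultiple x y) := inferInstanceAs (Decidable (_ ∧ _))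

/-- A test for `InSeries cov`. -/
def SeriesTest (i k j : Idx) : Prop :=
  IsSmallMultiple (encode (dcov i)) (encode (dcov k) + encode (dcov j)) ∨
    IsSmallMultiple (encode (dcov i)) (encode (dcov k) - encode (dcov j))

instance (i k j : Idx) : Decidable (SeriesTest i k j) := inferInstanceAs (Decidable (_ ∨ _))

theorem abs_dcov_le (k : Idx) (a : Fin 4) : |dcov k a| ≤ 2 := by
  have H : ∀ k a, |dcov k a| ≤ 2 := by decide +kernel
  exact H k a

theorem exists_dcov_ne_zero (k : Idx) : ∃ a, dcov k a ≠ 0 := by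
  revert k
  decide +kernel

theorem encode_dcov_ne_zero (k : Idx) : encode (dcov k) ≠ 0 := by
  revert k
  decide +kernel

/-- Base 64 leaves no room for carries: the entries compared are at most 4 and 8 in absolute value.
The bound 4 on the multiplier loses nothing, as some entry of `dcov i` is a non-zero integer. -/
theorem isSmallMultiple_encode_iff (i : Idx) {x : Fin 4 → ℤ} (hx : ∀ a, |x a| ≤ 4) :
    IsSmallMultiple (encode (dcov i)) (encode x) ↔ ∃ m : ℤ, x = m • dcov i := by
  constructor
  · rintro ⟨h, hm⟩
    refine ⟨encode x / encode (dcov i), ?_⟩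
    generalize encode x / encode (dcov i) = m at h hm
    have hb (a : Fin 4) : |m * dcov i a| ≤ 8 := by
      rw [abs_mul]
      exact (mul_le_mul hm (abs_dcov_le i a) (abs_nonneg _) (by norm_num)).trans (by norm_num)
    simp only [abs_le] at hb hx
    simp only [encode, mul_add, mul_left_comm m] at h
    have h0 := hb 0
    have h1 := hb 1
    have h2 := hb 2
    have h3 := hb 3
    have k0 := hx 0
    have k1 := hx 1
    have k2 := hx 2
    have k3 := hx 3
    ext a
    rw [Pi.smul_apply, smul_eq_mul]
    fin_cases a <;> simp <;> omega
  · rintro ⟨m, rfl⟩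
    have h1 : encode (m • dcov i) = m * encode (dcov i) := by
      simp only [encode, Pi.smul_apply, smul_eq_mul]
      ring
    rw [IsSmallMultiple, h1, Int.mul_ediv_cancel _ (encode_dcov_ne_zero i)]
    refine ⟨rfl, ?_⟩
    obtain ⟨a, ha⟩ := exists_dcov_ne_zero i
    have h2 := hx a
    rw [Pi.smul_apply, smul_eq_mul, abs_mul] at h2
    nlinarith [Int.one_le_abs ha, abs_nonneg m]

theorem eq_zsmul_cov_iff (i : Idx) {x : Fin 4 → ℤ} {β : Dual ℂ (Fin 4 → ℂ)}
    (hβ : ∀ a, β (Pi.single a 1) = (x a : ℂ) / 2) (m : ℤ) : β = m • cov i ↔ x = m • dcov i := by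
  constructor
  · intro h
    ext a
    have := LinearMap.congr_fun h (Pi.single a 1)
    rw [hβ, LinearMap.smul_apply, cov_single, zsmul_eq_mul, ← mul_div_assoc] at this
    have := mul_right_cancel₀ (b := (2 : ℂ)⁻¹) (by norm_num) this
    rw [Pi.smul_apply, smul_eq_mul]
    exact_mod_cast this
  · intro h
    refine (Pi.basisFun ℂ (Fin 4)).ext fun a => ?_
    rw [Pi.basisFun_apply, hβ, LinearMap.smul_apply, cov_single, h]
    simp
    ring

theorem inSeries_iff (i k j : Idx) : InSeries cov i k j ↔ SeriesTest i k j := by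
  have h1 : encode (dcov k) + encode (dcov j) = encode (dcov k + dcov j) := by
    simp only [encode, Pi.add_apply]
    ring
  have h2 : encode (dcov k) - encode (dcov j) = encode (dcov k - dcov j) := by
    simp only [encode, Pi.sub_apply]
    ring
  have h3 (a : Fin 4) : |(dcov k + dcov j) a| ≤ 4 :=
    (abs_add_le _ _).trans (by linarith [abs_dcov_le k a, abs_dcov_le j a])
  have h4 (a : Fin 4) : |(dcov k - dcov j) a| ≤ 4 :=
    (abs_sub _ _).trans (by linarith [abs_dcov_le k a, abs_dcov_le j a])
  rw [SeriesTest, h1, h2, isSmallMultiple_encode_iff i h3, isSmallMultiple_encode_iff i h4,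
    InSeries, ← exists_or]
  refine exists_congr fun m => or_congr ?_ ?_
  · exact eq_zsmul_cov_iff i (fun a => by simp [cov_single]; ring) m
  · exact eq_zsmul_cov_iff i (fun a => by simp [cov_single]; ring) m

-- This is the vee-condition with r and s split off, a finite check over the integers. Antisymmetry
-- in a, b leaves only a < b.
set_option maxHeartbeats 1000000 in
theorem sum_series_weight (i k : Idx) (a b : Fin 4) :
    ∑ j with SeriesTest i k j,
      (dcov i a * dcov j b - dcov j a * dcov i b) • weight i j = 0 := by
  have H : ∀ i k a b, a < b → ∑ j with SeriesTest i k j,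
      (dcov i a * dcov j b - dcov j a * dcov i b) • weight i j = 0 := by decide +kernel
  rcases lt_trichotomy a b with h | rfl | h
  · exact H i k a b h
  · simp [mul_comm]
  · rw [← neg_eq_zero, ← H i k b a h, ← Finset.sum_neg_distrib]
    refine Finset.sum_congr rfl fun j _ => ?_
    rw [← neg_smul]
    congr 1
    ring

theorem exists_basis_lattice : ∃ b : Basis (Fin (finrank ℂ (Fin 4 → ℂ))) ℂ (Dual ℂ (Fin 4 → ℂ)),
    ∀ k, cov k ∈ Submodule.span ℤ (Set.range b) := by
  set b₀ := ((Pi.basisFun ℂ (Fin 4)).dualBasis.isUnitSMul (w := fun _ => (1 / 2 : ℂ))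
    fun _ => isUnit_iff_ne_zero.2 (by norm_num)) with hb₀
  refine ⟨b₀.reindex (finCongr (Module.finrank_fin_fun ℂ).symm), fun k => ?_⟩
  have hk : cov k = ∑ i, dcov k i • b₀ i := by
    refine (Pi.basisFun ℂ (Fin 4)).ext fun a => ?_
    rw [Pi.basisFun_apply, cov_single, LinearMap.sum_apply, Finset.sum_eq_single a]
    · simp [hb₀, Basis.isUnitSMul_apply]
      ring
    · intro c _ hc
      simp [hb₀, Basis.isUnitSMul_apply, hc]
    · simp
  rw [hk, Basis.range_reindex]
  exact Submodule.sum_mem _ fun i _ =>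
    Submodule.smul_mem _ _ (Submodule.subset_span ⟨i, rfl⟩)

theorem nondegenerate_form_cov {p q r s : ℂ} (hg : ∀ i, gram p q r s i ≠ 0) :
    (form cov (mult p q r s)).Nondegenerate := by
  have hs : LinearMap.IsSymm (form cov (mult p q r s)) :=
    ⟨fun u v => by simp [form_apply, mul_comm (cov _ u)]⟩
  refine hs.isRefl.nondegenerate_iff_separatingLeft.2 ?_
  intro u hu
  ext i
  have := hu (Pi.single i 1)
  rw [form_cov_single] at this
  simpa [hg i] using this

theorem cov_vee {p q r s : ℂ} (hg : ∀ i, gram p q r s i ≠ 0)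
    (h : (form cov (mult p q r s)).Nondegenerate) (i j : Idx) :
    cov i (vee cov (mult p q r s) h (cov j))
      = 1 / 4 * ∑ a, (dcov i a : ℂ) * dcov j a / gram p q r s a := by
  have hv (a : Fin 4) : vee cov (mult p q r s) h (cov j) a
      = dcov j a / 2 / gram p q r s a := by
    rw [eq_div_iff (hg a), mul_comm, ← form_cov_single, ← cov_single]
    exact LinearMap.BilinForm.apply_toDual_symm_apply (hB := h) (cov j) _
  rw [cov_apply]
  simp only [hv, Finset.mul_sum]
  exact Finset.sum_congr rfl fun a _ => by ring

theorem isTrigVeeSystem_cov {p q r s : ℂ} (h : 4 * r + s ≠ 0) (hp : p = 2 * r + s)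
    (hq : q = s * (s - 2 * r) / (4 * r + s)) (hps : p * s ≠ 0) :
    IsTrigVeeSystem cov (mult p q r s) := by
  have hg := gram_ne_zero h hp hq hps
  refine ⟨exists_basis_lattice, nondegenerate_form_cov hg, fun i k _ => ?_⟩
  refine (Pi.basisFun ℂ (Fin 4)).ext fun a => (Pi.basisFun ℂ (Fin 4)).ext fun b => ?_
  have H := sum_series_weight i k a b
  have H1 := congrArg (Int.cast : ℤ → ℂ) (congrArg Prod.fst H)
  have H2 := congrArg (Int.cast : ℤ → ℂ) (congrArg Prod.snd H)
  simp only [Prod.fst_sum, Prod.snd_sum, Prod.smul_fst, Prod.smul_snd, Int.cast_sum, smul_eq_mul,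
    Prod.fst_zero, Prod.snd_zero, Int.cast_zero, Int.cast_mul, Int.cast_sub] at H1 H2
  simp only [LinearMap.sum_apply, LinearMap.smul_apply, wedge, LinearMap.sub_apply,
    LinearMap.smulRight_apply, Pi.basisFun_apply, cov_single, cov_vee hg, smul_eq_mul,
    LinearMap.zero_apply, inSeries_iff]
  calc _ = r / (48 * p) * ∑ j with SeriesTest i k j,
          ((dcov i a : ℂ) * dcov j b - dcov j a * dcov i b) * (weight i j).1
        + s / (48 * p) * ∑ j with SeriesTest i k j,
          ((dcov i a : ℂ) * dcov j b - dcov j a * dcov i b) * (weight i j).2 := by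
        rw [Finset.mul_sum, Finset.mul_sum, ← Finset.sum_add_distrib]
        refine Finset.sum_congr (by congr) fun j _ => ?_
        rw [mul_left_comm, mult_mul_sum_div_gram h hp hq hps]
        ring
    _ = 0 := by rw [H1, H2, mul_zero, mul_zero, add_zero]

/-! Branches of the multivalued function: the third derivative is the cotangent. -/

/-- The polylogarithm `Li_n(e^{-2iz})`. -/
def polylogExp (n : ℕ) (z : ℂ) : ℂ :=
  ∑' k : ℕ, Complex.exp (-2 * Complex.I * z) ^ (k + 1) / ((k : ℂ) + 1) ^ n

theorem norm_exp_neg_two_I_mul (z : ℂ) :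
    ‖Complex.exp (-2 * Complex.I * z)‖ = Real.exp (2 * z.im) := by
  rw [Complex.norm_exp]
  simp

theorem hasDerivAt_polylogExp (n : ℕ) {z : ℂ} (hz : z.im < 0) :
    HasDerivAt (polylogExp (n + 1)) (-2 * Complex.I * polylogExp n z) z := by
  -- On this half-plane |e^{-2iw}| ≤ e^{Im z} < 1, a uniform geometric bound that permits termwise
  -- differentiation.
  set U : Set ℂ := {w | w.im < z.im / 2} with hU
  have hUo : IsOpen U := isOpen_lt Complex.continuous_im continuous_const
  have hzU : z ∈ U := by
    change z.im < z.im / 2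
    linarith
  set F : ℕ → ℂ → ℂ := fun k w =>
    Complex.exp (-2 * Complex.I * w) ^ (k + 1) / ((k : ℂ) + 1) ^ (n + 1) with hF
  have hk (k : ℕ) : ((k : ℂ) + 1) ≠ 0 := Nat.cast_add_one_ne_zero k
  have hd (k : ℕ) (w : ℂ) : HasDerivAt (F k)
      (-2 * Complex.I * (Complex.exp (-2 * Complex.I * w) ^ (k + 1) / ((k : ℂ) + 1) ^ n)) w := by
    have h := ((((hasDerivAt_id w).const_mul (-2 * Complex.I)).cexp.pow (k + 1)).div_const
      (((k : ℂ) + 1) ^ (n + 1)))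
    refine h.congr_deriv ?_
    have := hk k
    simp only [id, Nat.add_sub_cancel]
    push_cast
    field_simp
    ring
  have hρ : Real.exp z.im < 1 := Real.exp_lt_one_iff.2 hz
  have hsum : Summable fun k : ℕ => Real.exp z.im ^ (k + 1) :=
    (summable_nat_add_iff 1).2 (summable_geometric_of_lt_one (Real.exp_nonneg _) hρ)
  have hbound (k : ℕ) (w : ℂ) (hw : w ∈ U) : ‖F k w‖ ≤ Real.exp z.im ^ (k + 1) := by
    rw [hF, norm_div, norm_pow, norm_pow, norm_exp_neg_two_I_mul]
    have h1 : (1 : ℝ) ≤ ‖(k : ℂ) + 1‖ := by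
      rw [← Nat.cast_add_one, Complex.norm_natCast]
      exact_mod_cast Nat.le_add_left 1 k
    refine (div_le_self (by positivity) (one_le_pow₀ h1)).trans ?_
    refine pow_le_pow_left₀ (Real.exp_nonneg _) (Real.exp_le_exp.2 ?_) _
    have : w.im < z.im / 2 := hw
    linarith
  have hdiff (k : ℕ) : DifferentiableOn ℂ (F k) U :=
    fun w _ => (hd k w).differentiableAt.differentiableWithinAt
  have h1 := Complex.hasSum_deriv_of_summable_norm hsum hdiff hUo hbound hzU
  have h2 := (Complex.differentiableOn_tsum_of_summable_norm hsum hdiff hUo hbound).differentiableAt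
    (hUo.mem_nhds hzU)
  refine h2.hasDerivAt.congr_deriv ?_
  rw [← h1.tsum_eq, polylogExp, ← tsum_mul_left]
  exact tsum_congr fun k => (hd k z).deriv

theorem polylogExp_zero {z : ℂ} (hz : z.im < 0) :
    polylogExp 0 z * (1 - Complex.exp (-2 * Complex.I * z)) = Complex.exp (-2 * Complex.I * z) := by
  have hn : ‖Complex.exp (-2 * Complex.I * z)‖ < 1 := by
    rw [norm_exp_neg_two_I_mul]
    exact Real.exp_lt_one_iff.2 (by linarith)
  have h1 : (1 - Complex.exp (-2 * Complex.I * z)) ≠ 0 := by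
    intro h
    rw [← sub_eq_zero.1 h] at hn
    simp at hn
  simp only [polylogExp, pow_zero, div_one, pow_succ', tsum_mul_left,
    tsum_geometric_of_norm_lt_one hn]
  rw [mul_assoc, inv_mul_cancel₀ h1, mul_one]

theorem deriv_eventuallyEq_of_hasDerivAt {f g : ℂ → ℂ} {U : Set ℂ} (hU : IsOpen U)
    (h : ∀ z ∈ U, HasDerivAt f (g z) z) {z : ℂ} (hz : z ∈ U) : deriv f =ᶠ[𝓝 z] g := by
  filter_upwards [hU.mem_nhds hz] with w hw using (h w hw).deriv

/-- Three differentiations lower Li_3 to the geometric series Li_0, and i(1+E)/(1-E) = cot z for E =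
e^{-2iz}. -/
theorem sin_mul_deriv_f₀ {z : ℂ} (hz : z.im < 0) :
    Complex.sin z * deriv (deriv (deriv f₀)) z = Complex.cos z := by
  have hU : IsOpen {w : ℂ | w.im < 0} := isOpen_lt Complex.continuous_im continuous_const
  have hI := Complex.I_mul_I
  have h1 (w : ℂ) (hw : w ∈ {w : ℂ | w.im < 0}) : HasDerivAt f₀
      (Complex.I / 2 * w ^ 2 - Complex.I / 2 * polylogExp 2 w) w := by
    refine ((((hasDerivAt_id w).pow 3).const_mul (Complex.I / 6)).add
      ((hasDerivAt_polylogExp 2 hw).const_mul (1 / 4))).congr_deriv ?_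
    simp
    ring
  have h2 (w : ℂ) (hw : w ∈ {w : ℂ | w.im < 0}) : HasDerivAt
      (fun w => Complex.I / 2 * w ^ 2 - Complex.I / 2 * polylogExp 2 w)
      (Complex.I * w - polylogExp 1 w) w := by
    refine ((((hasDerivAt_id w).pow 2).const_mul (Complex.I / 2)).sub
      ((hasDerivAt_polylogExp 1 hw).const_mul (Complex.I / 2))).congr_deriv ?_
    simp
    linear_combination polylogExp 1 w * hI
  have h3 (w : ℂ) (hw : w ∈ {w : ℂ | w.im < 0}) : HasDerivAt
      (fun w => Complex.I * w - polylogExp 1 w) (Complex.I + 2 * Complex.I * polylogExp 0 w) w := by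
    refine (((hasDerivAt_id w).const_mul Complex.I).sub
      (hasDerivAt_polylogExp 0 hw)).congr_deriv ?_
    ring
  have e1 := deriv_eventuallyEq_of_hasDerivAt hU h1 hz
  have e2 := e1.deriv.trans (deriv_eventuallyEq_of_hasDerivAt hU h2 hz)
  have e3 := e2.deriv.trans (deriv_eventuallyEq_of_hasDerivAt hU h3 hz)
  rw [e3.eq_of_nhds, Complex.sin, Complex.cos]
  have h := polylogExp_zero hz
  set E := Complex.exp (z * Complex.I) with hE
  have hE0 : E ≠ 0 := Complex.exp_ne_zero _
  have hE1 : Complex.exp (-z * Complex.I) = E⁻¹ := by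
    rw [hE, ← Complex.exp_neg, neg_mul]
  have hE2 : Complex.exp (-2 * Complex.I * z) = E⁻¹ * E⁻¹ := by
    rw [← hE1, ← Complex.exp_add]
    ring_nf
  rw [hE2] at h
  rw [hE1]
  field_simp at h ⊢
  linear_combination 2 * h + (1 - E ^ 2) * (1 + 2 * polylogExp 0 z) * hI

theorem analyticAt_f₀ {z : ℂ} (hz : z.im < 0) : AnalyticAt ℂ f₀ z := by
  have hU : IsOpen {w : ℂ | w.im < 0} := isOpen_lt Complex.continuous_im continuous_const
  refine DifferentiableOn.analyticAt (s := {w : ℂ | w.im < 0}) (fun w hw => ?_) (hU.mem_nhds hz)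
  refine DifferentiableAt.differentiableWithinAt ?_
  have := (hasDerivAt_polylogExp 2 hw).differentiableAt
  exact (((differentiableAt_id.pow 3).const_mul _).add (this.const_mul _))

/-- Written without division, the equation is analytic on all of the continuation domain and
propagates by the identity theorem. It is carried on a neighbourhood so that this theorem applies at
each step. -/
theorem IsBranchAt.analyticAt_and_eventually {f : ℂ → ℂ} {z : ℂ} (h : IsBranchAt f z) :
    AnalyticAt ℂ f z ∧
      ∀ᶠ w in 𝓝 z, Complex.sin w * deriv (deriv (deriv f)) w = Complex.cos w := by
  induction h with
  | base z hz =>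
    refine ⟨analyticAt_f₀ hz, ?_⟩
    filter_upwards [(isOpen_lt Complex.continuous_im continuous_const).mem_nhds hz] with w hw
    exact sin_mul_deriv_f₀ hw
  | continuation f U z w hU hU' hf hz hw _ ih =>
    refine ⟨hf w hw, ?_⟩
    have han : AnalyticOnNhd ℂ
        (fun w => Complex.sin w * deriv (deriv (deriv f)) w - Complex.cos w) U := by
      intro x hx
      have h3 := hf.deriv.deriv.deriv x hx
      exact (Complex.analyticAt_sin.mul h3).sub Complex.analyticAt_cos
    have h0 := han.eqOn_zero_of_preconnected_of_eventuallyEq_zero hU' hz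
      (by filter_upwards [ih.2] with x hx using sub_eq_zero.2 hx)
    filter_upwards [hU.mem_nhds hw] with x hx using sub_eq_zero.1 (h0 hx)
  | congr f g z hfg _ ih =>
    refine ⟨ih.1.congr hfg, ?_⟩
    filter_upwards [ih.2, hfg.deriv.deriv.deriv] with x hx hx'
    rw [← hx', hx]

theorem IsBranchAt.analyticAt {f : ℂ → ℂ} {z : ℂ} (h : IsBranchAt f z) : AnalyticAt ℂ f z :=
  h.analyticAt_and_eventually.1

theorem IsBranchAt.sin_mul_deriv {f : ℂ → ℂ} {z : ℂ} (h : IsBranchAt f z) :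
    Complex.sin z * deriv (deriv (deriv f)) z = Complex.cos z :=
  h.analyticAt_and_eventually.2.self_of_nhds

/-- At a zero of the sine the equation would make the cosine vanish as well; so no branch is
analytic at a point of πℤ. -/
theorem IsBranchAt.sin_ne_zero {f : ℂ → ℂ} {z : ℂ} (h : IsBranchAt f z) : Complex.sin z ≠ 0 := by
  intro hs
  have h1 := h.sin_mul_deriv
  have h2 := Complex.sin_sq_add_cos_sq z
  rw [← h1, hs] at h2
  simp at h2

/-! The third derivatives of the prepotential. -/

section Derivatives

variable {E : Type*} [NormedAddCommGroup E] [NormedSpace ℂ E] {κ : Type*} [Fintype κ]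
  (y : E →L[ℂ] ℂ) (A : κ → E →L[ℂ] ℂ) (c : κ → ℂ) (lam : ℂ) (f : ℂ → ℂ)

theorem fderiv_potential {X : E} (hf : ∀ k, AnalyticAt ℂ f (A k X)) (u : E) :
    fderiv ℂ (fun Y => 1 / 3 * y Y ^ 3 + (∑ k, c k * A k Y ^ 2) * y Y + lam * ∑ k, c k * f (A k Y))
      X u = y X ^ 2 * y u + ∑ k, c k * (2 * A k X * A k u * y X + A k X ^ 2 * y u)
        + lam * ∑ k, c k * A k u * deriv f (A k X) := by
  have hy : HasFDerivAt (fun Y => y Y) y X := y.hasFDerivAt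
  have hA (k : κ) : HasFDerivAt (fun Y => A k Y) (A k) X := (A k).hasFDerivAt
  have hfA (k : κ) : HasFDerivAt (fun Y => f (A k Y)) (deriv f (A k X) • A k) X :=
    (hf k).differentiableAt.hasDerivAt.comp_hasFDerivAt X (hA k)
  have h := (((hy.pow 3).const_mul (1 / 3)).add
    ((HasFDerivAt.fun_sum (u := Finset.univ) fun k _ => ((hA k).pow 2).const_mul (c k)).mul hy)).add
    ((HasFDerivAt.fun_sum (u := Finset.univ) fun k _ => (hfA k).const_mul (c k)).const_mul lam)
  refine (congrArg (fun L => L u) h.fderiv).trans ?_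
  simp only [add_apply, smul_apply,
    sum_apply, smul_eq_mul, nsmul_eq_mul, pow_one, Nat.cast_ofNat, Nat.add_one_sub_one]
  rw [Finset.sum_mul, Finset.mul_sum (a := y X), ← Finset.sum_add_distrib]
  exact congrArg₂ (· + ·) (congrArg₂ (· + ·) (by ring) (Finset.sum_congr rfl fun k _ => by ring))
    (congrArg (lam * ·) (Finset.sum_congr rfl fun k _ => by ring))

/-- Here `f` stands for the first derivative of the original function, and for the second derivative
in the next lemma. -/
theorem fderiv_fderiv_potential {X : E} (hf : ∀ k, AnalyticAt ℂ f (A k X)) (u v : E) :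
    fderiv ℂ (fun Y => y Y ^ 2 * y u + ∑ k, c k * (2 * A k Y * A k u * y Y + A k Y ^ 2 * y u)
        + lam * ∑ k, c k * A k u * f (A k Y)) X v =
      2 * y X * y v * y u + ∑ k, c k * (2 * A k v * A k u * y X + 2 * A k X * A k u * y v
        + 2 * A k X * A k v * y u) + lam * ∑ k, c k * A k u * A k v * deriv f (A k X) := by
  have hy : HasFDerivAt (fun Y => y Y) y X := y.hasFDerivAt
  have hA (k : κ) : HasFDerivAt (fun Y => A k Y) (A k) X := (A k).hasFDerivAt
  have hfA (k : κ) : HasFDerivAt (fun Y => f (A k Y)) (deriv f (A k X) • A k) X :=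
    (hf k).differentiableAt.hasDerivAt.comp_hasFDerivAt X (hA k)
  have h := (((hy.pow 2).mul_const (y u)).add
    (HasFDerivAt.fun_sum (u := Finset.univ) fun k _ =>
      (((((hA k).const_mul 2).mul_const (A k u)).mul hy).add
        (((hA k).pow 2).mul_const (y u))).const_mul (c k))).add
    ((HasFDerivAt.fun_sum (u := Finset.univ) fun k _ =>
      (hfA k).const_mul (c k * A k u)).const_mul lam)
  refine (congrArg (fun L => L v) h.fderiv).trans ?_
  simp only [add_apply, smul_apply,
    sum_apply, smul_eq_mul, nsmul_eq_mul, pow_one, Nat.cast_ofNat,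
    Nat.add_one_sub_one]
  exact congrArg₂ (· + ·) (congrArg₂ (· + ·) (by ring) (Finset.sum_congr rfl fun k _ => by ring))
    (congrArg (lam * ·) (Finset.sum_congr rfl fun k _ => by ring))

theorem fderiv_fderiv_fderiv_potential {X : E} (hf : ∀ k, AnalyticAt ℂ f (A k X)) (u v w : E) :
    fderiv ℂ (fun Y => 2 * y Y * y v * y u + ∑ k, c k * (2 * A k v * A k u * y Y
        + 2 * A k Y * A k u * y v + 2 * A k Y * A k v * y u)
        + lam * ∑ k, c k * A k u * A k v * f (A k Y)) X w =
      2 * y w * y v * y u + ∑ k, 2 * c k * (A k v * A k u * y w + A k w * A k u * y v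
        + A k w * A k v * y u) + lam * ∑ k, c k * A k u * A k v * A k w * deriv f (A k X) := by
  have hy : HasFDerivAt (fun Y => y Y) y X := y.hasFDerivAt
  have hA (k : κ) : HasFDerivAt (fun Y => A k Y) (A k) X := (A k).hasFDerivAt
  have hfA (k : κ) : HasFDerivAt (fun Y => f (A k Y)) (deriv f (A k X) • A k) X :=
    (hf k).differentiableAt.hasDerivAt.comp_hasFDerivAt X (hA k)
  have h := ((((hy.const_mul 2).mul_const (y v)).mul_const (y u)).add
    (HasFDerivAt.fun_sum (u := Finset.univ) fun k _ =>
      (((hy.const_mul (2 * A k v * A k u)).add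
        ((((hA k).const_mul 2).mul_const (A k u)).mul_const (y v))).add
        ((((hA k).const_mul 2).mul_const (A k v)).mul_const (y u))).const_mul (c k))).add
    ((HasFDerivAt.fun_sum (u := Finset.univ) fun k _ =>
      (hfA k).const_mul (c k * A k u * A k v)).const_mul lam)
  refine (congrArg (fun L => L w) h.fderiv).trans ?_
  simp only [add_apply, smul_apply,
    sum_apply, smul_eq_mul]
  exact congrArg₂ (· + ·) (congrArg₂ (· + ·) (by ring) (Finset.sum_congr rfl fun k _ => by ring))
    (congrArg (lam * ·) (Finset.sum_congr rfl fun k _ => by ring))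

end Derivatives

section Prepotential

variable {N : ℕ} {κ : Type*} [Fintype κ] (α : κ → Dual ℂ (Fin N → ℂ)) (c : κ → ℂ) (lam : ℂ)
  (f : ℂ → ℂ)

/-- The covector `α` on `ℂ^N`, as a covector on `ℂ^{N+1}`. -/
def liftCov (α : Dual ℂ (Fin N → ℂ)) : (Fin (N + 1) → ℂ) →L[ℂ] ℂ :=
  LinearMap.toContinuousLinearMap (α ∘ₗ LinearMap.funLeft ℂ ℂ Fin.castSucc)

theorem liftCov_apply (α : Dual ℂ (Fin N → ℂ)) (X : Fin (N + 1) → ℂ) :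
    liftCov α X = α (Fin.init X) := rfl

theorem eventually_pd_eq {n : ℕ} {p : Fin n} {G H K : (Fin n → ℂ) → ℂ} {X : Fin n → ℂ}
    (h : ∀ᶠ Z in 𝓝 X, G Z = H Z) (h' : ∀ᶠ Z in 𝓝 X, fderiv ℂ H Z (Pi.single p 1) = K Z) :
    ∀ᶠ Z in 𝓝 X, pd p G Z = K Z := by
  filter_upwards [Filter.EventuallyEq.eventuallyEq_nhds h, h'] with Z h1 h2
  rw [pd, h1.fderiv_eq, h2]

theorem thirdDeriv_prepotential {X : Fin (N + 1) → ℂ}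
    (hf : ∀ k, AnalyticAt ℂ f (α k (Fin.init X))) (i p q : Fin (N + 1)) :
    let y (j : Fin (N + 1)) : ℂ := (Pi.single j 1 : Fin (N + 1) → ℂ) (Fin.last N)
    let a (k : κ) (j : Fin (N + 1)) : ℂ := liftCov (α k) (Pi.single j 1)
    thirdDeriv (prepotential α c lam f) X i p q = 2 * y i * y p * y q
      + ∑ k, 2 * c k * (a k p * a k q * y i + a k i * a k q * y p + a k i * a k p * y q)
      + lam * ∑ k, c k * a k q * a k p * a k i * deriv (deriv (deriv f)) (α k (Fin.init X)) := by
  intro y a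
  set A : κ → (Fin (N + 1) → ℂ) →L[ℂ] ℂ := fun k => liftCov (α k)
  set Y : (Fin (N + 1) → ℂ) →L[ℂ] ℂ := ContinuousLinearMap.proj (Fin.last N)
  have hev : ∀ᶠ Z in 𝓝 X, ∀ k, AnalyticAt ℂ f (A k Z) :=
    Filter.eventually_all.2 fun k => (A k).continuous.continuousAt.eventually
      (hf k).eventually_analyticAt
  have e1 : ∀ᶠ Z in 𝓝 X, _ = _ :=
    hev.mono fun Z hZ => fderiv_potential Y A c lam f hZ (Pi.single q 1)
  have e2 := eventually_pd_eq e1 (p := p) (hev.mono fun Z hZ =>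
    fderiv_fderiv_potential Y A c lam (deriv f) (fun k => (hZ k).deriv) (Pi.single q 1) _)
  have e3 := eventually_pd_eq e2 (p := i) (hev.mono fun Z hZ =>
    fderiv_fderiv_fderiv_potential Y A c lam (deriv (deriv f)) (fun k => (hZ k).deriv.deriv)
      (Pi.single q 1) (Pi.single p 1) _)
  exact e3.self_of_nhds

theorem analyticAt_prepotential {X : Fin (N + 1) → ℂ}
    (hf : ∀ k, AnalyticAt ℂ f (α k (Fin.init X))) : AnalyticAt ℂ (prepotential α c lam f) X := by
  have hy : AnalyticAt ℂ (fun X : Fin (N + 1) → ℂ => X (Fin.last N)) X :=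
    (ContinuousLinearMap.proj (R := ℂ) (φ := fun _ => ℂ) (Fin.last N)).analyticAt X
  have hA (k : κ) : AnalyticAt ℂ (fun X => α k (Fin.init X)) X := (liftCov (α k)).analyticAt X
  have hs : AnalyticAt ℂ (fun X : Fin (N + 1) → ℂ => ∑ k, c k * α k (Fin.init X) ^ 2) X :=
    Finset.analyticAt_fun_sum _ fun k _ => analyticAt_const.mul ((hA k).pow 2)
  have hfs : AnalyticAt ℂ (fun X : Fin (N + 1) → ℂ => ∑ k, c k * f (α k (Fin.init X))) X :=
    Finset.analyticAt_fun_sum _ fun k _ => analyticAt_const.mul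
      (AnalyticAt.comp (g := f) (f := fun X : Fin (N + 1) → ℂ => α k (Fin.init X)) (hf k) (hA k))
  exact ((analyticAt_const.mul (hy.pow 3)).add (hs.mul hy)).add (analyticAt_const.mul hfs)

end Prepotential

/-! The WDVV equations as an identity between tensors. -/

section Tensor

variable {N : ℕ} {κ : Type*} [Fintype κ] {α : κ → Dual ℂ (Fin N → ℂ)} {c : κ → ℂ}

/-- The WDVV equations in the case that `G` is diagonal with entries `g`. -/
theorem solvesWDVVAt_prepotential (lam : ℂ) {f : ℂ → ℂ} {X : Fin (N + 1) → ℂ}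
    (hf : ∀ k, AnalyticAt ℂ f (α k (Fin.init X))) {g : Fin N → ℂ} (hg0 : ∀ i, g i ≠ 0)
    (hg : ∀ i j, ∑ k, c k * (α k (Pi.single i 1) * α k (Pi.single j 1)) = if i = j then g i else 0)
    (T : Fin N → Fin N → Fin N → ℂ)
    (hT : ∀ i j l, T i j l = ∑ k, c k * α k (Pi.single i 1) * α k (Pi.single j 1)
      * α k (Pi.single l 1) * deriv (deriv (deriv f)) (α k (Fin.init X)))
    (h : ∀ i j k l, lam ^ 2 * ∑ m, (T i k m * T j m l - T j k m * T i m l) / g m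
      + 4 * ((if i = k then g i else 0) * (if j = l then g j else 0)
        - (if j = k then g j else 0) * (if i = l then g i else 0)) = 0) :
    SolvesWDVVAt (prepotential α c lam f) X := by
  have hlast (k : κ) : liftCov (α k) (Pi.single (Fin.last N) 1) = 0 := by
    rw [liftCov_apply]
    convert! map_zero (α k)
    ext j
    simp [Fin.init, (Fin.castSucc_lt_last j).ne]
  have hcast (k : κ) (j : Fin N) :
      liftCov (α k) (Pi.single j.castSucc 1) = α k (Pi.single j 1) := by
    rw [liftCov_apply]
    congr 1
    ext l
    by_cases hl : l = j
    · subst hl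
      simp [Fin.init]
    · simp [Fin.init, hl]
  have hy (j : Fin N) : (Pi.single j.castSucc 1 : Fin (N + 1) → ℂ) (Fin.last N) = 0 := by
    simp [(Fin.castSucc_lt_last j).ne']
  have h3 := thirdDeriv_prepotential α c lam f hf
  have e1 (i j l : Fin N) : thirdDeriv (prepotential α c lam f) X i.castSucc j.castSucc l.castSucc
      = lam * T i j l := by
    rw [h3]
    simp only [hcast, hy, hT]
    simp only [mul_zero, add_zero, Finset.sum_const_zero, zero_add]
    exact congrArg (lam * ·) (Finset.sum_congr rfl fun k _ => by ring)
  have e2 (i j : Fin N) :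
      thirdDeriv (prepotential α c lam f) X i.castSucc j.castSucc (Fin.last N)
        = 2 * if i = j then g i else 0 := by
    rw [h3, ← hg]
    simp only [hcast, hlast, hy, Pi.single_eq_same]
    simp [mul_assoc, Finset.mul_sum]
  have e3 (i j : Fin N) :
      thirdDeriv (prepotential α c lam f) X i.castSucc (Fin.last N) j.castSucc
        = 2 * if i = j then g i else 0 := by
    rw [h3, ← hg]
    simp only [hcast, hlast, hy, Pi.single_eq_same]
    simp [mul_assoc, Finset.mul_sum]
  have e4 (i : Fin N) :
      thirdDeriv (prepotential α c lam f) X i.castSucc (Fin.last N) (Fin.last N) = 0 := by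
    rw [h3]
    simp only [hcast, hlast, hy, Pi.single_eq_same]
    simp
  -- F_{N+1} does not involve `f`: its diagonal is 2g_i from the term in α(x)² y, and 2 from y³/3.
  set d : Fin (N + 1) → ℂ := Fin.snoc (fun i => 2 * g i) 2 with hd
  have hd0 (i : Fin (N + 1)) : d i ≠ 0 := by
    refine Fin.lastCases ?_ (fun i => ?_) i
    · simp [hd]
    · simp [hd, hg0]
  have e5 : thirdDeriv (prepotential α c lam f) X (Fin.last N) = Matrix.diagonal d := by
    ext p q
    rw [h3]
    refine Fin.lastCases ?_ (fun p => ?_) p <;> refine Fin.lastCases ?_ (fun q => ?_) q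
    · simp only [hlast, Pi.single_eq_same]
      simp [hd]
    · simp only [hcast, hlast, hy, Pi.single_eq_same]
      simp [(Fin.castSucc_lt_last q).ne']
    · simp only [hcast, hlast, hy, Pi.single_eq_same]
      simp [(Fin.castSucc_lt_last p).ne]
    · have := hg p q
      simp only [hcast, hlast, hy, Pi.single_eq_same]
      simp only [Matrix.diagonal_apply, Fin.castSucc_inj, hd, Fin.snoc_castSucc]
      simp only [mul_zero, zero_mul, add_zero, zero_add, mul_one, Finset.sum_const_zero, mul_assoc,
        ← Finset.mul_sum, this]
      split_ifs <;> simp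
  refine ⟨analyticAt_prepotential α c lam f hf, ?_, fun i j => ?_⟩
  · rw [e5, Matrix.det_diagonal, isUnit_iff_ne_zero]
    exact Finset.prod_ne_zero_iff.2 fun i _ => hd0 i
  have hinv : (Matrix.diagonal d)⁻¹ = Matrix.diagonal fun i => (d i)⁻¹ := by
    refine Matrix.inv_eq_right_inv ?_
    rw [Matrix.diagonal_mul_diagonal, ← Matrix.diagonal_one]
    congr 1
    ext i
    exact mul_inv_cancel₀ (hd0 i)
  rw [e5, hinv]
  ext k l
  simp only [Matrix.mul_apply (M := _ * _), Matrix.mul_diagonal, Fin.sum_univ_castSucc]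
  have hT1 (i j l) : T i j l = T j i l := by
    rw [hT, hT]
    exact Finset.sum_congr rfl fun k _ => by ring
  have hT2 (i j l) : T i j l = T i l j := by
    rw [hT, hT]
    exact Finset.sum_congr rfl fun k _ => by ring
  refine Fin.lastCases ?_ (fun k => ?_) k <;> refine Fin.lastCases ?_ (fun l => ?_) l
  · simp only [e3, e2, e4, hd, Fin.snoc_castSucc]
    simp
    by_cases hij : i = j
    · rw [hij]
    · simp [hij, Ne.symm hij]
  · simp only [e3, e1, e4, hd, Fin.snoc_castSucc]
    have hi := hg0 i
    have hj := hg0 j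
    simp [hT1 i j]
    left
    field_simp
  · simp only [e2, e1, e4, hd, Fin.snoc_castSucc]
    simp only [mul_zero, add_zero, mul_ite, ite_mul, zero_mul, Finset.sum_ite_eq,
      Finset.mem_univ, if_true]
    rw [hT1 i k j, hT1 j k i, hT2 k i j]
    have hi := hg0 i
    have hj := hg0 j
    field_simp
  -- Only this block uses `h`; the entries with an index N+1 agree by the symmetry of `T`. The
  -- summand at N+1 of the matrix product yields the constant terms, and the equation is half of
  -- `h`.
  · simp only [e2, e3, e1, hd, Fin.snoc_castSucc, Fin.snoc_last]
    have := h i j k l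
    have e6 : ∑ m, (T i k m * T j m l - T j k m * T i m l) / g m
      = ∑ m, T i k m * T j m l / g m - ∑ m, T j k m * T i m l / g m := by
      rw [← Finset.sum_sub_distrib]
      exact Finset.sum_congr rfl fun m _ => by ring
    have e7 (i j : Fin N) : ∑ m, lam * T i k m * (2 * g m)⁻¹ * (lam * T j m l)
        = lam ^ 2 / 2 * ∑ m, T i k m * T j m l / g m := by
      rw [Finset.mul_sum]
      refine Finset.sum_congr rfl fun m _ => ?_
      have := hg0 m
      field_simp
    rw [e6] at this
    rw [e7, e7]
    linear_combination this / 2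

end Tensor

theorem cot_mul_cot_add {x y z u v w : ℂ} (h : x + y + z = 0)
    (hx : Complex.sin x * u = Complex.cos x)
    (hy : Complex.sin y * v = Complex.cos y) (hz : Complex.sin z * w = Complex.cos z)
    (hx0 : Complex.sin x ≠ 0) (hy0 : Complex.sin y ≠ 0) : u * v + v * w + w * u = 1 := by
  obtain rfl : z = -(x + y) := by linear_combination h
  rw [Complex.sin_neg, Complex.cos_neg, Complex.sin_add, Complex.cos_add, ← hx, ← hy] at hz
  apply mul_left_cancel₀ (mul_ne_zero hx0 hy0)
  linear_combination -hz

/-! The tensor identity for the configuration. -/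

/-- The coefficients of `r ^ 2`, `r s`, `s ^ 2` in `12 p c_a c_b α_a(α_b^∨)`. -/
def quadWeight (a b : Idx) : ℤ × ℤ × ℤ :=
  match a with
  | .inl _ => (2 * (weight a b).1, (weight a b).1 + 2 * (weight a b).2, (weight a b).2)
  | .inr (.inl _) => (dcov a 3 * dcov b 3) • (0, -2, 1)
  | .inr (.inr (.inl _)) => ((weight a b).1, (weight a b).2, 0)
  | .inr (.inr (.inr _)) => (0, (weight a b).1, (weight a b).2)

/-- Triples of indices with two signs. -/
abbrev Triple : Type := Idx × Idx × Idx × ℤˣ × ℤˣ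

/-- The relation `a + ε b + δ c = 0`. -/
def Triple.IsRelation (t : Triple) : Prop :=
  encode (dcov t.1) + t.2.2.2.1 * encode (dcov t.2.1) + t.2.2.2.2 * encode (dcov t.2.2.1) = 0

instance (t : Triple) : Decidable t.IsRelation := inferInstanceAs (Decidable (_ = _))

/-- A numbering of the four kinds of covectors for which the sum over a relation determines the
kinds that occur in it. -/
def kind : Idx → ℕ
  | .inl _ => 0
  | .inr (.inl _) => 2
  | .inr (.inr (.inl _)) => 1
  | .inr (.inr (.inr _)) => 10

/-- The common value of `12 p c_a c_b α_a(α_b^∨)`, up to sign, for the pairs in a relation, except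
for the pairs of orthogonal covectors. -/
def relWeight (a b c : Idx) : ℤ × ℤ × ℤ :=
  match kind a + kind b + kind c with
  | 1 => (8, 4, 0)
  | 3 => (4, 0, 0)
  | 20 => (0, 4, 2)
  | 21 => (0, 4, 0)
  | 22 => (0, -4, 2)
  | _ => 0

-- One pair may lie in several relations: e^i and e^j occur with both e^i + e^j and e^i - e^j, and
-- the two contributions cancel, as orthogonality requires.
set_option maxHeartbeats 1000000 in
theorem quadWeight_eq (a b : Idx) (hab : a ≠ b) : quadWeight a b
    = ∑ x : Idx × ℤˣ × ℤˣ, if Triple.IsRelation (a, b, x) then -((x.2.1 : ℤ) • relWeight a b x.1)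
      else 0 := by
  have H : ∀ a b, a ≠ b → quadWeight a b = ∑ c,
      ((if encode (dcov a) + encode (dcov b) = -encode (dcov c) then -relWeight a b c else 0)
      + (if encode (dcov a) + encode (dcov b) = encode (dcov c) then -relWeight a b c else 0)
      + (if encode (dcov a) - encode (dcov b) = -encode (dcov c) then relWeight a b c else 0)
      + (if encode (dcov a) - encode (dcov b) = encode (dcov c) then relWeight a b c else 0)) := by
    decide +kernel
  rw [H a b hab, Fintype.sum_prod_type]
  refine Finset.sum_congr rfl fun c _ => ?_
  have hne : (1 : ℤˣ) ≠ -1 := by decide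
  have h1 : Triple.IsRelation (a, b, c, 1, 1) ↔
      encode (dcov a) + encode (dcov b) = -encode (dcov c) := by
    simp only [Triple.IsRelation, Units.val_one]
    omega
  have h2 : Triple.IsRelation (a, b, c, 1, -1) ↔
      encode (dcov a) + encode (dcov b) = encode (dcov c) := by
    simp only [Triple.IsRelation, Units.val_one, Units.val_neg]
    omega
  have h3 : Triple.IsRelation (a, b, c, -1, 1) ↔
      encode (dcov a) - encode (dcov b) = -encode (dcov c) := by
    simp only [Triple.IsRelation, Units.val_one, Units.val_neg]
    omega
  have h4 : Triple.IsRelation (a, b, c, -1, -1) ↔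
      encode (dcov a) - encode (dcov b) = encode (dcov c) := by
    simp only [Triple.IsRelation, Units.val_one, Units.val_neg]
    omega
  simp only [Fintype.sum_prod_type, UnitsInt.univ, Finset.sum_pair hne, h1, h2, h3, h4,
    Units.val_one, Units.val_neg, one_smul, neg_smul, neg_neg, add_assoc]

/-- Each covector has a positive first non-zero coordinate, so no three of them add up to zero. -/
theorem not_isRelation_one (a b c : Idx) : ¬ Triple.IsRelation (a, b, c, 1, 1) := by
  revert a b c
  decide +kernel

/-- `(a ∧ b)_{ij}` in doubled coordinates. -/
def minor (a b : Idx) (i j : Fin 4) : ℤ := dcov a i * dcov b j - dcov a j * dcov b i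

theorem minor_swap (a b : Idx) (i j : Fin 4) : minor a b i j = -minor a b j i := by
  simp only [minor]
  ring

set_option maxHeartbeats 1000000 in
theorem sum_minor_mul_quadWeight (i j k l : Fin 4) :
    ∑ a, ∑ b, (minor a b i j * minor a b k l) • quadWeight a b
      = ((if i = k ∧ j = l then 1 else 0) - (if i = l ∧ j = k then 1 else 0) : ℤ) •
        (if i = 3 ∨ j = 3 then (0, 256, 128) else (1024, 768, 128) : ℤ × ℤ × ℤ) := by
  have H : ∀ i j k l, i < j → k < l → ∑ a, ∑ b, (minor a b i j * minor a b k l) • quadWeight a b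
      = ((if i = k ∧ j = l then 1 else 0) - (if i = l ∧ j = k then 1 else 0) : ℤ) •
        (if i = 3 ∨ j = 3 then (0, 256, 128) else (1024, 768, 128) : ℤ × ℤ × ℤ) := by
    decide +kernel
  have H1 (i j k l : Fin 4) (hij : i < j) :
      ∑ a, ∑ b, (minor a b i j * minor a b k l) • quadWeight a b
      = ((if i = k ∧ j = l then 1 else 0) - (if i = l ∧ j = k then 1 else 0) : ℤ) •
        (if i = 3 ∨ j = 3 then (0, 256, 128) else (1024, 768, 128) : ℤ × ℤ × ℤ) := by
    rcases lt_trichotomy k l with h | rfl | h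
    · exact H i j k l hij h
    · simp [minor, mul_comm]
    · simp only [minor_swap _ _ k l, mul_neg, neg_smul, Finset.sum_neg_distrib, H i j l k hij h]
      rw [← neg_smul, neg_sub]
  rcases lt_trichotomy i j with h | rfl | h
  · exact H1 i j k l h
  · simp [minor, and_comm]
  · simp only [minor_swap _ _ i j, neg_mul, neg_smul, Finset.sum_neg_distrib, H1 j i k l h]
    rw [← neg_smul, neg_sub]
    simp only [and_comm (a := j = l), and_comm (a := j = k), or_comm (a := j = 3)]

/-! ### Relations, their rotations and the constancy of the sum. -/

theorem Triple.IsRelation.eq_zero {a b c : Idx} {ε δ : ℤˣ} (h : Triple.IsRelation (a, b, c, ε, δ))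
    (i : Fin 4) : dcov a i + ε * dcov b i + δ * dcov c i = 0 := by
  have ha (i) := abs_le.1 (abs_dcov_le a i)
  have hb (i) := abs_le.1 (abs_dcov_le b i)
  have hc (i) := abs_le.1 (abs_dcov_le c i)
  have ha0 := ha 0
  have ha1 := ha 1
  have ha2 := ha 2
  have ha3 := ha 3
  have hb0 := hb 0
  have hb1 := hb 1
  have hb2 := hb 2
  have hb3 := hb 3
  have hc0 := hc 0
  have hc1 := hc 1
  have hc2 := hc 2
  have hc3 := hc 3
  simp only [Triple.IsRelation, encode] at h
  rcases Int.units_eq_one_or ε with rfl | rfl <;> rcases Int.units_eq_one_or δ with rfl | rfl <;>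
    simp only [Units.val_one, Units.val_neg] at h ⊢ <;> fin_cases i <;> simp <;> omega

/-- Cyclic rotation of relations: `a + ε b + δ c = 0` becomes `b + ε δ c + ε a = 0`. -/
def Triple.rotate : Triple ≃ Triple where
  toFun t := (t.2.1, t.2.2.1, t.1, t.2.2.2.1 * t.2.2.2.2, t.2.2.2.1)
  invFun t := (t.2.2.1, t.1, t.2.1, t.2.2.2.2, t.2.2.2.1 * t.2.2.2.2)
  left_inv t := by
    obtain ⟨a, b, c, ε, δ⟩ := t
    simp [mul_comm ε δ, mul_assoc]
  right_inv t := by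
    obtain ⟨a, b, c, ε, δ⟩ := t
    simp [mul_comm ε δ, ← mul_assoc]

theorem Triple.isRelation_rotate (t : Triple) : t.rotate.IsRelation ↔ t.IsRelation := by
  obtain ⟨a, b, c, ε, δ⟩ := t
  simp only [Triple.IsRelation, Triple.rotate, Equiv.coe_fn_mk]
  rcases Int.units_eq_one_or ε with rfl | rfl <;> rcases Int.units_eq_one_or δ with rfl | rfl <;>
    simp <;> omega

/-- Substituting for a in a∧b gives a∧b = δ b∧c, and the sign disappears in a product of two minors.
-/
theorem Triple.IsRelation.minor_eq {a b c : Idx} {ε δ : ℤˣ}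
    (h : Triple.IsRelation (a, b, c, ε, δ)) (i j k l : Fin 4) :
    minor b c i j * minor b c k l = minor a b i j * minor a b k l := by
  have key (i j : Fin 4) : minor a b i j = δ * minor b c i j := by
    have hi := h.eq_zero i
    have hj := h.eq_zero j
    simp only [minor]
    linear_combination dcov b j * hi - dcov b i * hj
  have hδ : (δ : ℤ) * δ = 1 := by rw [← Units.val_mul, Int.units_mul_self, Units.val_one]
  rw [key, key]
  linear_combination (-minor b c i j * minor b c k l) * hδ

theorem relWeight_rotate (a b c : Idx) : relWeight b c a = relWeight a b c := by
  rw [relWeight, relWeight, show kind b + kind c + kind a = kind a + kind b + kind c by ring]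

/-- The value of a triple of integers as coefficients of `r ^ 2`, `r s`, `s ^ 2`. -/
def evalQuad (r s : ℂ) : ℤ × ℤ × ℤ →+ ℂ where
  toFun x := x.1 * r ^ 2 + x.2.1 * (r * s) + x.2.2 * s ^ 2
  map_zero' := by simp
  map_add' x y := by
    simp only [Prod.fst_add, Prod.snd_add, Int.cast_add]
    ring

/-- The sum of the products of pairs of functions with the cotangent relations depends only on the
relations. -/
theorem three_mul_sum_eq (r s : ℂ) (D : Idx → ℂ)
    (hD : ∀ a b c ε δ, Triple.IsRelation (a, b, c, ε, δ) →
      (ε : ℤ) * (D a * D b) + ((ε : ℤ) * (δ : ℤ)) * (D b * D c) + (δ : ℤ) * (D c * D a) = 1)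
    (i j k l : Fin 4) :
    3 * ∑ a, ∑ b, ((minor a b i j * minor a b k l : ℤ) : ℂ) * evalQuad r s (quadWeight a b)
        * (D a * D b)
      = -∑ t : Triple, if t.IsRelation then ((minor t.1 t.2.1 i j * minor t.1 t.2.1 k l : ℤ) : ℂ)
          * evalQuad r s (relWeight t.1 t.2.1 t.2.2.1) else 0 := by
  set F : Triple → ℂ := fun t => if t.IsRelation then
    ((minor t.1 t.2.1 i j * minor t.1 t.2.1 k l : ℤ) : ℂ)
      * evalQuad r s (relWeight t.1 t.2.1 t.2.2.1)
      * ((t.2.2.2.1 : ℤ) * (D t.1 * D t.2.1)) else 0 with hF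
  have h1 : ∑ a, ∑ b, ((minor a b i j * minor a b k l : ℤ) : ℂ) * evalQuad r s (quadWeight a b)
      * (D a * D b) = -∑ t, F t := by
    rw [Fintype.sum_prod_type, ← Finset.sum_neg_distrib]
    refine Finset.sum_congr rfl fun a _ => ?_
    rw [Fintype.sum_prod_type, ← Finset.sum_neg_distrib]
    refine Finset.sum_congr rfl fun b _ => ?_
    by_cases hab : a = b
    · subst hab
      simp [hF, minor, mul_comm]
    · rw [quadWeight_eq a b hab, map_sum, Finset.mul_sum, Finset.sum_mul,
        ← Finset.sum_neg_distrib]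
      refine Finset.sum_congr rfl fun x _ => ?_
      simp only [hF]
      split_ifs
      · rw [map_neg, map_zsmul, zsmul_eq_mul]
        ring
      · simp
  -- Averaging over the three rotations collects the three products of one relation, whose signed
  -- sum is 1 by `hD`.
  have h2 : ∑ t : Triple, F t.rotate = ∑ t, F t := Equiv.sum_comp _ _
  have h3 : ∑ t : Triple, F t.rotate.rotate = ∑ t, F t := (Equiv.sum_comp Triple.rotate
    fun t => F t.rotate).trans h2
  rw [h1, mul_neg, show (3 : ℂ) * ∑ t, F t = ∑ t, F t + ∑ t : Triple, F t.rotate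
    + ∑ t : Triple, F t.rotate.rotate by
    rw [h2, h3]; ring, ← Finset.sum_add_distrib, ← Finset.sum_add_distrib]
  refine congrArg _ (Finset.sum_congr rfl fun t _ => ?_)
  simp only [hF, Triple.isRelation_rotate]
  by_cases ht : t.IsRelation
  · simp only [ht, if_true]
    have ht' : t.rotate.IsRelation := t.isRelation_rotate.2 ht
    obtain ⟨a, b, c, ε, δ⟩ := t
    have h4 := ht.minor_eq i j k l
    have h5 := ht'.minor_eq i j k l
    have h6 := hD a b c ε δ ht
    simp only [Triple.rotate, Equiv.coe_fn_mk] at h5 ⊢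
    have hε' : ε * δ * ε = δ := by rw [mul_comm ε δ, mul_assoc, Int.units_mul_self, mul_one]
    rw [h5, h4, relWeight_rotate b c a, relWeight_rotate a b c, hε']
    push_cast at h6 ⊢
    linear_combination (minor a b i j * minor a b k l : ℂ) * evalQuad r s (relWeight a b c) * h6
  · simp [ht]

/-- The value i is the limit of cot z as Im z → -∞. It satisfies the relations for every choice of
signs except ε = δ = 1, which does not occur. -/
theorem I_relation (a b c : Idx) (ε δ : ℤˣ) (h : Triple.IsRelation (a, b, c, ε, δ)) :
    (ε : ℤ) * (Complex.I * Complex.I) + ((ε : ℤ) * (δ : ℤ)) * (Complex.I * Complex.I)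
      + (δ : ℤ) * (Complex.I * Complex.I) = 1 := by
  rw [Complex.I_mul_I]
  rcases Int.units_eq_one_or ε with rfl | rfl
  · rcases Int.units_eq_one_or δ with rfl | rfl
    · exact absurd h (not_isRelation_one a b c)
    · simp
  · rcases Int.units_eq_one_or δ with rfl | rfl <;> simp

theorem sum_minor_mul_evalQuad (r s : ℂ) (D : Idx → ℂ)
    (hD : ∀ a b c ε δ, Triple.IsRelation (a, b, c, ε, δ) →
      (ε : ℤ) * (D a * D b) + ((ε : ℤ) * (δ : ℤ)) * (D b * D c) + (δ : ℤ) * (D c * D a) = 1)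
    (i j k l : Fin 4) :
    ∑ a, ∑ b, ((minor a b i j * minor a b k l : ℤ) : ℂ) * evalQuad r s (quadWeight a b)
        * (D a * D b)
      = -(((if i = k ∧ j = l then 1 else 0) - (if i = l ∧ j = k then 1 else 0)) *
        (if i = 3 ∨ j = 3 then 128 * s * (2 * r + s) else 128 * (2 * r + s) * (4 * r + s))) := by
  have h1 := three_mul_sum_eq r s D hD i j k l
  have h2 := three_mul_sum_eq r s (fun _ => Complex.I) I_relation i j k l
  have h3 := congrArg (evalQuad r s) (sum_minor_mul_quadWeight i j k l)
  rw [mul_left_cancel₀ (three_ne_zero (α := ℂ)) (h1.trans h2.symm)]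
  simp only [Complex.I_mul_I, mul_neg, mul_one, Finset.sum_neg_distrib]
  have hz (n : ℤ) (x : ℤ × ℤ × ℤ) : evalQuad r s (n • x) = n * evalQuad r s x := by
    rw [map_zsmul, zsmul_eq_mul]
  simp only [map_sum, hz] at h3
  rw [h3]
  split_ifs <;> simp [evalQuad] <;> ring

theorem cot_relation {D : Idx → ℂ} {x : Fin 4 → ℂ}
    (h : ∀ k, Complex.sin (cov k x) * D k = Complex.cos (cov k x))
    (h0 : ∀ k, Complex.sin (cov k x) ≠ 0) (a b c : Idx) (ε δ : ℤˣ)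
    (hr : Triple.IsRelation (a, b, c, ε, δ)) :
    (ε : ℤ) * (D a * D b) + ((ε : ℤ) * (δ : ℤ)) * (D b * D c) + (δ : ℤ) * (D c * D a) = 1 := by
  have hsum : cov a x + (ε : ℤ) * cov b x + (δ : ℤ) * cov c x = 0 := by
    simp only [cov_apply, Finset.mul_sum, ← Finset.sum_add_distrib]
    refine Finset.sum_eq_zero fun i _ => ?_
    have := congrArg (Int.cast : ℤ → ℂ) (hr.eq_zero i)
    push_cast at this
    linear_combination 1 / 2 * x i * this
  have key (ε : ℤˣ) (k : Idx) :
      Complex.sin ((ε : ℤ) * cov k x) * ((ε : ℤ) * D k) = Complex.cos ((ε : ℤ) * cov k x) ∧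
      Complex.sin ((ε : ℤ) * cov k x) ≠ 0 := by
    rcases Int.units_eq_one_or ε with rfl | rfl <;> simp [h, h0]
  have := cot_mul_cot_add hsum (h a) (key ε b).1 (key δ c).1 (h0 a) (key ε b).2
  linear_combination this

/-- The factor `minor` is needed for a = b = e^4 only, where q² leaves a denominator; the minor
vanishes there. For the other pairs with a = e^4, either the product is zero or q(4r+s) = s(s-2r)
clears the denominator. -/
theorem minor_mul_quadWeight {p q r s : ℂ} (h : 4 * r + s ≠ 0) (hp : p = 2 * r + s)
    (hq : q = s * (s - 2 * r) / (4 * r + s)) (hps : p * s ≠ 0) (a b : Idx) (i j : Fin 4) :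
    (minor a b i j : ℂ) * (mult p q r s a * (mult p q r s b *
      ∑ m, (dcov a m : ℂ) * dcov b m / gram p q r s m))
        = minor a b i j * evalQuad r s (quadWeight a b) / (3 * p) := by
  rw [mult_mul_sum_div_gram h hp hq hps, mul_div_assoc, ← mul_div_assoc (mult p q r s a)]
  rcases a with a | _ | ⟨x, ε⟩ | ε
  · simp only [mult, quadWeight, evalQuad, AddMonoidHom.coe_mk, ZeroHom.coe_mk, hp]
    push_cast
    ring
  · have h0 : dcov (.inr (.inl ())) 0 = 0 ∧ dcov (.inr (.inl ())) 1 = 0 ∧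
      dcov (.inr (.inl ())) 2 = 0 := by decide
    have hq' : q * (4 * r + s) = s * (s - 2 * r) := by rw [hq, div_mul_cancel₀ _ h]
    rcases b with b | _ | x | ε
    · have : ∀ x, dcov (.inl x) 3 = 0 := by decide
      simp [weight, quadWeight, h0, this]
    · have : minor (.inr (.inl ())) (.inr (.inl ())) i j = 0 := by
        simp only [minor]
        ring
      simp [this]
    · have : ∀ x, dcov (.inr (.inr (.inl x))) 3 = 0 := by decide +kernel
      simp [weight, quadWeight, h0, this]
    · simp [weight, quadWeight, h0, weightCoeff, mult, evalQuad]
      left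
      congr 1
      linear_combination (dcov (.inr (.inl ())) 3 : ℂ) * dcov (.inr (.inr (.inr ε))) 3 * hq'
  · simp only [mult, quadWeight, evalQuad, AddMonoidHom.coe_mk, ZeroHom.coe_mk, hp]
    push_cast
    ring
  · simp only [mult, quadWeight, evalQuad, AddMonoidHom.coe_mk, ZeroHom.coe_mk, hp]
    push_cast
    ring

theorem sum_contraction {p q r s : ℂ} (h : 4 * r + s ≠ 0) (hp : p = 2 * r + s)
    (hq : q = s * (s - 2 * r) / (4 * r + s)) (hps : p * s ≠ 0) (D : Idx → ℂ) (i j k l : Fin 4) :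
    ∑ m, ((∑ a, mult p q r s a * cov a (Pi.single i 1) * cov a (Pi.single k 1)
      * cov a (Pi.single m 1) * D a) * (∑ b, mult p q r s b * cov b (Pi.single j 1)
      * cov b (Pi.single m 1) * cov b (Pi.single l 1) * D b)
      - (∑ a, mult p q r s a * cov a (Pi.single j 1) * cov a (Pi.single k 1)
      * cov a (Pi.single m 1) * D a) * (∑ b, mult p q r s b * cov b (Pi.single i 1)
      * cov b (Pi.single m 1) * cov b (Pi.single l 1) * D b)) / gram p q r s m
      = 1 / (384 * p) * ∑ a, ∑ b, ((minor a b i j * minor a b k l : ℤ) : ℂ)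
        * evalQuad r s (quadWeight a b) * (D a * D b) := by
  set W : Idx → Idx → ℂ := fun a b => mult p q r s a * (mult p q r s b *
      ∑ m, (dcov a m : ℂ) * dcov b m / gram p q r s m) with hW
  have hWsymm (a b : Idx) : W a b = W b a := by
    simp only [hW]
    rw [mul_left_comm]
    simp only [mul_comm (dcov a _ : ℂ)]
  have h1 : ∀ m, ((∑ a, mult p q r s a * cov a (Pi.single i 1) * cov a (Pi.single k 1)
      * cov a (Pi.single m 1) * D a) * (∑ b, mult p q r s b * cov b (Pi.single j 1)
      * cov b (Pi.single m 1) * cov b (Pi.single l 1) * D b)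
      - (∑ a, mult p q r s a * cov a (Pi.single j 1) * cov a (Pi.single k 1)
      * cov a (Pi.single m 1) * D a) * (∑ b, mult p q r s b * cov b (Pi.single i 1)
      * cov b (Pi.single m 1) * cov b (Pi.single l 1) * D b)) / gram p q r s m
      = ∑ a, ∑ b, 1 / 64 * (mult p q r s a * (mult p q r s b *
        ((dcov a m : ℂ) * dcov b m / gram p q r s m))) * (D a * D b) * minor a b i j
        * (dcov a k * dcov b l) := by
    intro m
    rw [Finset.sum_mul_sum, Finset.sum_mul_sum, ← Finset.sum_sub_distrib, Finset.sum_div]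
    refine Finset.sum_congr rfl fun a _ => ?_
    rw [← Finset.sum_sub_distrib, Finset.sum_div]
    refine Finset.sum_congr rfl fun b _ => ?_
    simp only [cov_single, minor]
    push_cast
    ring
  have h2 : ∑ m, ∑ a, ∑ b, 1 / 64 * (mult p q r s a * (mult p q r s b *
        ((dcov a m : ℂ) * dcov b m / gram p q r s m))) * (D a * D b) * minor a b i j
        * (dcov a k * dcov b l)
      = ∑ a, ∑ b, 1 / 64 * W a b * (D a * D b) * minor a b i j * (dcov a k * dcov b l) := by
    rw [Finset.sum_comm]
    refine Finset.sum_congr rfl fun a _ => ?_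
    rw [Finset.sum_comm]
    refine Finset.sum_congr rfl fun b _ => ?_
    simp only [hW, Finset.mul_sum, Finset.sum_mul]
  -- Exchanging a and b reverses the first minor; the mean of the two expressions contains the
  -- second minor. The constant is 384 = 64 · 2 · 3, from six halved coordinates, the mean and the
  -- denominator 3p.
  have h3 : ∑ a, ∑ b, 1 / 64 * W a b * (D a * D b) * minor a b i j * (dcov a k * dcov b l)
      = ∑ a, ∑ b, 1 / 64 * W a b * (D a * D b) * minor a b i j * (-(dcov b k * dcov a l)) := by
    rw [Finset.sum_comm]
    refine Finset.sum_congr rfl fun a _ => Finset.sum_congr rfl fun b _ => ?_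
    rw [hWsymm b a, show minor b a i j = -minor a b i j by simp only [minor]; ring]
    push_cast
    ring
  rw [Finset.sum_congr rfl fun m _ => h1 m, h2]
  have h4 : ∀ x y z : ℂ, x = y → x + y = 2 * z → x = z := fun x y z h h' => by
    linear_combination (h + h') / 2
  refine h4 _ _ _ h3 ?_
  rw [← Finset.sum_add_distrib, Finset.mul_sum, Finset.mul_sum]
  refine Finset.sum_congr rfl fun a _ => ?_
  rw [← Finset.sum_add_distrib, Finset.mul_sum, Finset.mul_sum]
  refine Finset.sum_congr rfl fun b _ => ?_
  have h5 : (minor a b i j : ℂ) * W a b = _ := minor_mul_quadWeight h hp hq hps a b i j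
  have h6 : (minor a b k l : ℂ) = dcov a k * dcov b l - dcov b k * dcov a l := by
    simp only [minor]
    push_cast
    ring
  push_cast
  rw [h6]
  linear_combination 1 / 64 * (D a * D b) * (dcov a k * dcov b l - dcov b k * dcov a l : ℂ) * h5

theorem prepotentialSolvesWDVV_cov {p q r s : ℂ} (h : 4 * r + s ≠ 0) (hp : p = 2 * r + s)
    (hq : q = s * (s - 2 * r) / (4 * r + s)) (hps : p * s ≠ 0) {lam : ℂ}
    (hlam : lam ^ 2 * (4 * r + s) = 108 * p ^ 2) :
    PrepotentialSolvesWDVV cov (mult p q r s) lam := by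
  intro f X hf
  have hp0 : p ≠ 0 := left_ne_zero_of_mul hps
  have hs0 : s ≠ 0 := right_ne_zero_of_mul hps
  have hg0 := gram_ne_zero h hp hq hps
  set D : Idx → ℂ := fun k => deriv (deriv (deriv f)) (cov k (Fin.init X)) with hD
  have hrel := cot_relation (D := D) (fun k => (hf k).sin_mul_deriv) fun k => (hf k).sin_ne_zero
  refine solvesWDVVAt_prepotential lam (fun k => (hf k).analyticAt) hg0 (fun i j => ?_) _
    (fun i j l => rfl) fun i j k l => ?_
  · have := sum_mult_mul_dcov p q r s i j
    simp only [cov_single]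
    refine mul_left_cancel₀ (show (4 : ℂ) ≠ 0 by norm_num) ?_
    rw [Finset.mul_sum]
    refine (Finset.sum_congr rfl fun k _ => ?_).trans (this.trans ?_)
    · ring
    · split_ifs <;> simp
  have hsum := sum_minor_mul_evalQuad r s D hrel i j k l
  rw [sum_contraction h hp hq hps D i j k l, hsum]
  -- The pairs of indices with and without the fourth coordinate impose the same condition, λ²(4r+s)
  -- = 108p².
  have hg (i j : Fin 4) (hij : i ≠ j) : lam ^ 2 * (1 / (384 * p) * (if i = 3 ∨ j = 3 then
      128 * s * (2 * r + s) else 128 * (2 * r + s) * (4 * r + s)))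
        = 4 * (gram p q r s i * gram p q r s j) := by
    rw [← hp, gram_eq h hp hq, gram_eq h hp hq, eq_div_iff h |>.2 hlam]
    have hn : ¬ (i = 3 ∧ j = 3) := fun h => hij (h.1.trans h.2.symm)
    by_cases hi : i = 3
    · have hj : j ≠ 3 := fun h => hij (hi.trans h.symm)
      simp only [hi, hj, true_or, if_true, if_false]
      field_simp
      norm_num
    · by_cases hj : j = 3 <;> simp only [hi, hj, or_true, or_self, if_true, if_false] <;>
        field_simp <;> norm_num
  by_cases hij : i = j
  · subst hij
    by_cases hik : i = k <;> by_cases hil : i = l <;> simp [hik, hil]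
  · have := hg i j hij
    by_cases hik : i = k
    · have hjk : j ≠ k := fun h => hij (hik.trans h.symm)
      by_cases hjl : j = l
      · obtain rfl := hik
        obtain rfl := hjl
        simp only [hij, Ne.symm hij, and_self, if_true, if_false]
        linear_combination -this
      · simp [hjl, hjk]
    · by_cases hil : i = l
      · have hjl : j ≠ l := fun h => hij (hil.trans h.symm)
        by_cases hjk : j = k
        · obtain rfl := hjk
          obtain rfl := hil
          simp only [hij, Ne.symm hij, and_self, if_true, if_false]
          linear_combination this
        · simp [hik, hjk]
      · simp [hik, hil]

end

end TrigVee

/-! ### The main theorem. -/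

theorem mainTheorem8 :
    (∀ p q r s : ℂ, 4 * r + s ≠ 0 → p = 2 * r + s → q = s * (s - 2 * r) / (4 * r + s) →
      p * s ≠ 0 →
      TrigVee.IsTrigVeeSystem TrigVee.cov (TrigVee.mult p q r s) ∧
      -- `μ` is either of the two square roots of `4r + s`
      ∀ μ : ℂ, μ ^ 2 = 4 * r + s →
        TrigVee.PrepotentialSolvesWDVV TrigVee.cov (TrigVee.mult p q r s)
          (6 * (Real.sqrt 3 : ℂ) * (2 * r + s) * μ⁻¹)) ∧
    -- in general the configuration is not a restriction of a root system
    ∃ T : Set ℂ, T.Countable ∧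
      ∀ p q r s : ℂ, 4 * r + s ≠ 0 → p = 2 * r + s → q = s * (s - 2 * r) / (4 * r + s) →
        p * s ≠ 0 → r / s ∉ T →
        ¬ TrigVee.IsRestrictionOfRootSystem TrigVee.cov (TrigVee.mult p q r s) := by
  refine ⟨fun p q r s h hp hq hps => ⟨TrigVee.isTrigVeeSystem_cov h hp hq hps, fun μ hμ => ?_⟩,
    -- The values of r/s for which 4r/s + 1 is rational.
    Set.range fun t : ℚ => ((t : ℂ) - 1) / 4, Set.countable_range _,
    fun p q r s h hp hq hps hT => TrigVee.not_isRestrictionOfRootSystem h hp hq hps fun t ht =>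
      hT ⟨t, ?_⟩⟩
  · refine TrigVee.prepotentialSolvesWDVV_cov h hp hq hps ?_
    have hμ0 : μ ≠ 0 := by
      rintro rfl
      exact h (by simpa using hμ.symm)
    have h3 : ((Real.sqrt 3 : ℝ) : ℂ) ^ 2 = 3 := by
      rw [← Complex.ofReal_pow, Real.sq_sqrt (by norm_num)]
      norm_num
    rw [← hp, ← hμ]
    simp only [mul_pow, h3, inv_pow]
    field_simp
    ring
  · change ((t : ℂ) - 1) / 4 = r / s
    rw [← ht]
    ring
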